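/- **Setting.** Let $L,T>0$, let $\mathbb T^3_L$ be the torus of side length $L$, $\Omega_T=[0,T]\times\mathbb T^3_L$, and let $\langle\cdot\rangle$ denote the average over $\Omega_T$. Put $\lambda_q=2^q/L$, $\ell_q=\lambda_q^{-1}$. Fix a nonnegative radial $\chi\in C_0^\infty(B(0,1))$ on $\mathbb R^3$ with $\chi=1$ for $|\xi|\le\frac12$, let $\phi(\xi)=\chi(\xi/2)-\chi(\xi)$, $\varphi_{-1}(\xi)=\chi(L\xi)$, $\varphi_q(\xi)=\phi(L\xi/2^q)$ for $q\ge0$, and let $v_q=\mathcal F^{-1}(\varphi_q\mathcal F v)$ be the Littlewood–Paley blocks of a field $v$ on $\mathbb T^3_L$ (Fourier series over $\frac1L\mathbb Z^3$). For a time dependent field $v:[0,T]\to L^2(\mathbb T^3_L)$ let $\varepsilon(v)=\limsup_{q\to\infty}\lambda_q\langle|v_q|^3\rangle$. *Flux.* The energy flux density of $u$ is $$\pi_q=\sum_{\substack{p'\ge q-1,\ p''\ge q,\ -1\le p'''<q\\ |p'-p''|<2}}(u_{p'}\otimes u_{p''}):\nabla u_{p'''},\qquad (a\otimes b):\nabla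 v=\sum_{i,j}a_ib_j\,\partial_iv_j .$$ The flux *concentrates* on a measurable set $G\subset\Omega_T$ if there is a decreasing sequence of relatively open sets $G_q\subset\Omega_T$ with $G=\bigcap_qG_q$ and $\lim_{p\to\infty}\langle|\pi_p|\,\mathbf 1_{\Omega_T\setminus G_q}\rangle=0$ for every $q\in\mathbb N$. *Active regions.* For $q\ge0$ and $k\in[0,2^q-1]^3\cap\mathbb Z^3$ let $Q_{qk}=[0,\ell_q)^3+\ell_qk\subset\mathbb T^3_L$, and let $Q^*_{qk}$ be the open dilated cube, the interior of $\bigcup_{|k'-k|_\infty<3}Q_{qk'}$ (indices modulo $2^q$). Fix an integer $M>1$, a smooth kernel $\eta$ on $\mathbb R^3$ with $\operatorname{supp}\eta\subset B(0,1)$ and $\int\eta=1$, put $\eta_q(x)=2^{3q}\eta(\lambda_qx)$ and $\chi'_{qk}=\mathbf 1_{Q_{qk}}\star\eta_q$ (convolution normalized by $L^{-3}$), and let $$s_{qk}(t)=\max_{|\beta|\le M}\lambda_q^{-|\beta|}\,\big\|\partial_x^\beta\big(u_q(t,\cdot)\,\chi'_{qk}\big)\big\|_\infty .$$ Fix a positive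 decreasing sequence $\sigma_q\to0$ with $\lim_{q\to\infty}\frac{\log\sigma_q}{q}=0$. Let $A_q$ be the set of all $(t,x)\in\Omega_T$ such that $x\in Q^*_{qk}$ for some $k$ with $s_{qk}(t)>\sigma_q\langle|u_q|^3\rangle/\langle|u_q|^2\rangle$ (with $A_q=\emptyset$ if $u_q=0$), and let $A=\limsup_{q\to\infty}A_q=\bigcap_{p}\bigcup_{q>p}A_q$. *Singular set.* A relatively open set $U\subset\Omega_T$ is a set of Onsager regularity of $u$ if $\varepsilon(u\varphi)=0$ for every scalar $\varphi\in C_0^\infty(U)$. Let $S\subset\Omega_T$ be the complement of the union of all such $U$. **Theorem.** Let $f,u_0\in L^2(\mathbb T^3_L;\mathbb R^3)$ and let $u\in C_w([0,T];L^2(\mathbb T^3_L))$ be a weak solution of the Euler equations $\partial_tu+(u\cdot\nabla)u=-\nabla p+f$, $\nabla\cdot u=0$ with time independent force $f$ and initial data $u_0$: that is, $\nabla\cdot u(t)=0$ in the sense of distributions for all $t\in[0,T]$, and for every $\psi\in C^\infty([0,T]\times\mathbb T^3_L;\mathbb R^3)$ with $\nabla_x\cdot\psi=0$ and every $t\in[0,T]$,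 $$\int_{\mathbb T^3_L}u(t)\cdot\psi(t)-\int_{\mathbb T^3_L}u_0\cdot\psi(0)-\int_0^t\!\!\int_{\mathbb T^3_L}u\cdot\partial_s\psi=\int_0^t\!\!\int_{\mathbb T^3_L}(u\otimes u):\nabla\psi+\int_0^t\!\!\int_{\mathbb T^3_L}f\cdot\psi .$$ Suppose that $\varepsilon(u)=\limsup_{q\to\infty}\lambda_q\langle|u_q|^3\rangle<\infty$. Then the energy flux concentrates on $A\cap S$. -/

import Mathlib

open MeasureTheory Set Filter Topology
open scoped ENNReal ContDiff

noncomputable section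

namespace Intermittency

/-- Three-dimensional Euclidean space. -/
abbrev E3 : Type := EuclideanSpace ℝ (Fin 3)

/-- The torus of side length `L`, with its Lebesgue measure (of total mass `L ^ 3`). -/
abbrev Torus (L : ℝ) : Type := Fin 3 → AddCircle L

/-- The space-time domain `[0, T] × 𝕋³_L`.  Its open sets are the relatively open sets. -/
abbrev SpaceTime (L T : ℝ) : Type := Icc (0 : ℝ) T × Torus L

/-- Square integrable vector fields on the torus. -/
abbrev L2Field (L : ℝ) [Fact (0 < L)] : Type := Lp E3 2 (volume : Measure (Torus L))

/-- The covering map of the torus. -/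
def toTorus (L : ℝ) (y : E3) : Torus L := fun i => (y i : AddCircle L)

/-- The time interval `[0, T]` carries the restriction of Lebesgue measure. -/
instance timeMeasureSpace (T : ℝ) : MeasureSpace (Icc (0 : ℝ) T) := Measure.Subtype.measureSpace

/-! ### Calculus on the torus -/

/-- The partial derivative in the direction of the `i`-th coordinate. -/
def pderiv {L : ℝ} {F : Type*} [NormedAddCommGroup F] [NormedSpace ℝ F]
    (i : Fin 3) (g : Torus L → F) (x : Torus L) : F :=
  deriv (fun s : ℝ => g (x + Pi.single i (s : AddCircle L))) 0

/-- The partial derivative of multi-index `β`. -/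
def mderiv {L : ℝ} {F : Type*} [NormedAddCommGroup F] [NormedSpace ℝ F]
    (β : Fin 3 → ℕ) (g : Torus L → F) : Torus L → F :=
  (pderiv 0)^[β 0] ((pderiv 1)^[β 1] ((pderiv 2)^[β 2] g))

/-- Smooth functions of `x` on the torus. -/
def SmoothOnTorus {L : ℝ} {F : Type*} [NormedAddCommGroup F] [NormedSpace ℝ F]
    (g : Torus L → F) : Prop :=
  ContDiff ℝ ∞ (fun y : E3 => g (toTorus L y))

/-- Smooth functions of `(t, x)`; their restrictions to `[0, T] × 𝕋³_L` are the functions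
that are smooth up to the boundary. -/
def SmoothInSpaceTime {L : ℝ} {F : Type*} [NormedAddCommGroup F] [NormedSpace ℝ F]
    (g : ℝ → Torus L → F) : Prop :=
  ContDiff ℝ ∞ (fun p : ℝ × E3 => g p.1 (toTorus L p.2))

/-- `(a ⊗ b) : ∇v` at the point `x`, with `A : B = tr (A B)` and `∇v` the Jacobian matrix,
that is `∑ a_i b_j ∂_i v_j`. -/
def contractGrad {L : ℝ} (a b : E3) (v : Torus L → E3) (x : Torus L) : ℝ :=
  ∑ i, ∑ j, a i * b j * (pderiv i v x) j

/-! ### Littlewood-Paley decomposition -/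

/-- The radial cut-off function `χ` generating the dyadic decomposition. -/
structure Cutoff where
  toFun : E3 → ℝ
  smooth : ContDiff ℝ ∞ toFun
  compactSupport : HasCompactSupport toFun
  support_subset : tsupport toFun ⊆ Metric.ball 0 1
  nonneg : ∀ ξ, 0 ≤ toFun ξ
  radial : ∀ ξ ξ', ‖ξ‖ = ‖ξ'‖ → toFun ξ = toFun ξ'
  eq_one : ∀ ξ, ‖ξ‖ ≤ 1 / 2 → toFun ξ = 1

/-- The wave number `λ_q = 2 ^ q / L`. -/
def lam (L : ℝ) (q : ℤ) : ℝ := 2 ^ q / L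

/-- The length scale `ℓ_q = 1 / λ_q`. -/
def ell (L : ℝ) (q : ℤ) : ℝ := (lam L q)⁻¹

/-- The multipliers: `φ_{-1}(ξ) = χ(Lξ)`, and `φ_q(ξ) = φ(Lξ / 2 ^ q)` for `q ≥ 0`, where
`φ(ξ) = χ(ξ / 2) - χ(ξ)`.  Only the indices `q ≥ -1` occur. -/
def multiplier (χ : Cutoff) (L : ℝ) (q : ℤ) (ξ : E3) : ℝ :=
  if q < -1 then 0
  else if q = -1 then χ.toFun (L • ξ)
  else χ.toFun ((1 / 2 : ℝ) • (L / 2 ^ q) • ξ) - χ.toFun ((L / 2 ^ q) • ξ)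

/-- The character `x ↦ exp (2 π i (k / L) · x)` of the torus, `k ∈ ℤ³`. -/
def character {L : ℝ} (k : Fin 3 → ℤ) (x : Torus L) : ℂ := ∏ i, fourier (k i) (x i)

/-- The `i`-th component of the Fourier coefficient of `v` at the frequency `k / L`. -/
def fourierCoef {L : ℝ} [Fact (0 < L)] (v : Torus L → E3) (k : Fin 3 → ℤ) (i : Fin 3) : ℂ :=
  (1 / (L : ℂ) ^ 3) * ∫ x : Torus L, ((v x i : ℝ) : ℂ) * character (-k) x

/-- The frequency `k / L`. -/
def freq (L : ℝ) (k : Fin 3 → ℤ) : E3 := WithLp.toLp 2 (fun i => (k i : ℝ) / L)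

/-- The Littlewood-Paley block `v_q`.  Only finitely many terms of the sum are nonzero, and
since `v` is real and the multiplier is even, the sum is real. -/
def block (χ : Cutoff) {L : ℝ} [Fact (0 < L)] (q : ℤ) (v : Torus L → E3) (x : Torus L) : E3 :=
  WithLp.toLp 2 (fun i =>
    (∑' k : Fin 3 → ℤ,
      (multiplier χ L q (freq L k) : ℂ) * fourierCoef v k i * character k x).re)

/-- The space-time average `⟨|g| ^ r⟩` over `[0, T] × 𝕋³_L`. -/
def avgPow {L T : ℝ} [Fact (0 < L)] {F : Type*} [NormedAddCommGroup F]
    (r : ℕ) (g : SpaceTime L T → F) : ℝ≥0∞ :=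
  ⨍⁻ z : SpaceTime L T, ‖g z‖ₑ ^ r

/-- The block `v_q` of a time dependent field as a function on space-time. -/
def blockST (χ : Cutoff) {L T : ℝ} [Fact (0 < L)] (v : Icc (0 : ℝ) T → Torus L → E3)
    (q : ℤ) (z : SpaceTime L T) : E3 :=
  block χ q (v z.1) z.2

/-- `ε(v) = limsup λ_q ⟨|v_q|³⟩`. -/
def onsager (χ : Cutoff) {L T : ℝ} [Fact (0 < L)] (v : Icc (0 : ℝ) T → Torus L → E3) : ℝ≥0∞ :=
  limsup (fun q : ℕ => ENNReal.ofReal (lam L q) * avgPow 3 (blockST χ v q)) atTop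

/-! ### Weak solutions of the Euler equations -/

/-- Weak continuity in time with values in `L²`. -/
def WeaklyContinuous {L T : ℝ} [Fact (0 < L)] (u : Icc (0 : ℝ) T → L2Field L) : Prop :=
  ∀ w : L2Field L, Continuous (fun t => inner ℝ (u t) w)

/-- `∇ · v = 0` in the sense of distributions on the torus. -/
def DivFree {L : ℝ} [Fact (0 < L)] (v : Torus L → E3) : Prop :=
  ∀ θ : Torus L → ℝ, SmoothOnTorus θ → ∫ x : Torus L, ∑ i, v x i * pderiv i θ x = 0

/-- `u ∈ C_w([0, T]; L²)` is a weak solution of the Euler equations with time independent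
force `f` and initial data `u₀`. -/
structure IsWeakEulerSolution {L T : ℝ} [Fact (0 < L)] (f u₀ : L2Field L)
    (u : Icc (0 : ℝ) T → L2Field L) : Prop where
  weaklyContinuous : WeaklyContinuous u
  divFree : ∀ t, DivFree (u t)
  momentum : ∀ ψ : ℝ → Torus L → E3, SmoothInSpaceTime ψ →
    (∀ s ∈ Icc (0 : ℝ) T, ∀ x, ∑ i, (pderiv i (ψ s) x) i = 0) →
    ∀ t : Icc (0 : ℝ) T,
      (∫ x, inner ℝ (u t x) (ψ t x)) - (∫ x, inner ℝ (u₀ x) (ψ 0 x))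
          - (∫ s in Iic t, ∫ x, inner ℝ (u s x) (deriv (fun r : ℝ => ψ r x) s))
        = (∫ s in Iic t, ∫ x, contractGrad (u s x) (u s x) (ψ s) x)
          + ∫ s in Iic t, ∫ x, inner ℝ (f x) (ψ s x)

/-! ### Energy flux -/

/-- The energy flux density `π_q`: the sum of `(u_{p'} ⊗ u_{p''}) : ∇u_{p'''}` over
`p' ≥ q - 1`, `p'' ≥ q`, `|p' - p''| < 2` and `-1 ≤ p''' < q`.  For square integrable `v t` the
series converges absolutely almost everywhere. -/
def fluxDensity (χ : Cutoff) {L T : ℝ} [Fact (0 < L)] (v : Icc (0 : ℝ) T → Torus L → E3)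
    (q : ℤ) (z : SpaceTime L T) : ℝ :=
  ∑' P : ℤ × ℤ,
    if q - 1 ≤ P.1 ∧ q ≤ P.2 ∧ |P.1 - P.2| < 2 then
      ∑ p ∈ Finset.Ico (-1) q,
        contractGrad (blockST χ v P.1 z) (blockST χ v P.2 z) (block χ p (v z.1)) z.2
    else 0

/-- The sequence of densities `π` concentrates on the measurable set `G`. -/
def FluxConcentratesOn {L T : ℝ} [Fact (0 < L)] (π : ℕ → SpaceTime L T → ℝ)
    (G : Set (SpaceTime L T)) : Prop :=
  MeasurableSet G ∧ ∃ H : ℕ → Set (SpaceTime L T),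
    Antitone H ∧ (∀ q, IsOpen (H q)) ∧ G = ⋂ q, H q ∧
      ∀ q, Tendsto (fun p => avgPow 1 ((H q)ᶜ.indicator (π p))) atTop (𝓝 0)

/-! ### Atomic decomposition and active regions -/

/-- A smooth approximation kernel `η` supported on the unit ball. -/
structure ApproxKernel where
  toFun : E3 → ℝ
  smooth : ContDiff ℝ ∞ toFun
  support_subset : tsupport toFun ⊆ Metric.closedBall 0 1
  integral_eq_one : ∫ y, toFun y = 1

/-- The dyadic cube `Q_{qk} = [0, ℓ_q)³ + ℓ_q k` in the torus. -/
def dyadicCube (L : ℝ) (q : ℕ) (k : Fin 3 → ℤ) : Set (Torus L) :=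
  toTorus L '' {y : E3 | ∀ i, y i - ell L q * k i ∈ Ico 0 (ell L q)}

/-- The (open) dilated cube `Q*_{qk}`: the interior of the union of the cubes `Q_{qk'}` with
`|k' - k| < 3` in the maximum norm. -/
def dilatedCube (L : ℝ) (q : ℕ) (k : Fin 3 → ℤ) : Set (Torus L) :=
  interior (⋃ k' ∈ {k' : Fin 3 → ℤ | ∀ i, |k' i - k i| < 3}, dyadicCube L q k')

/-- The mollified indicator function `χ'_{qk} = χ_{qk} ⋆ η_q`, with
`η_q(y) = 2 ^ (3q) η(λ_q y)`; the convolution on the torus is normalized by `1 / L³`, so that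
the sum of `χ'_{qk}` over the cubes of generation `q` is one. -/
def cubeBump (η : ApproxKernel) (L : ℝ) (q : ℕ) (k : Fin 3 → ℤ) (x : Torus L) : ℝ :=
  (1 / L ^ 3) * ∫ y : E3,
    (dyadicCube L q k).indicator (fun _ => (1 : ℝ)) (x - toTorus L y) *
      (2 ^ (3 * q) * η.toFun (lam L q • y))

/-- The coefficient `s_{qk}` of the atomic decomposition into `M`-atoms of a field `v`
on the torus: the maximum over `|β| ≤ M` of `λ_q ^ (-|β|) ‖∂^β (v_q χ'_{qk})‖_∞`. -/
def atomCoef (χ : Cutoff) (η : ApproxKernel) (M : ℕ) {L : ℝ} [Fact (0 < L)]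
    (v : Torus L → E3) (q : ℕ) (k : Fin 3 → ℤ) : ℝ≥0∞ :=
  ⨆ β ∈ {β : Fin 3 → ℕ | ∑ i, β i ≤ M},
    ENNReal.ofReal ((lam L q ^ (∑ i, β i))⁻¹) *
      ⨆ x : Torus L, ‖mderiv β (fun y => cubeBump η L q k y • block χ q v y) x‖ₑ

/-- The active region `A_q`: the union of the dilated cubes whose coefficient `s_{qk}(t)`
exceeds `σ_q ⟨|u_q|³⟩ / ⟨|u_q|²⟩` (no cube is active if `u_q` vanishes). -/
def activeRegion (χ : Cutoff) (η : ApproxKernel) (M : ℕ) (σ : ℕ → ℝ) {L T : ℝ} [Fact (0 < L)]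
    (v : Icc (0 : ℝ) T → Torus L → E3) (q : ℕ) : Set (SpaceTime L T) :=
  {z | ∃ k : Fin 3 → ℤ, (∀ i, 0 ≤ k i ∧ k i < 2 ^ q) ∧
    ENNReal.ofReal (σ q) * (avgPow 3 (blockST χ v q) / avgPow 2 (blockST χ v q))
      < atomCoef χ η M (v z.1) q k ∧
    z.2 ∈ dilatedCube L q k}

/-- `A = limsup A_q`. -/
def activeLimsup (χ : Cutoff) (η : ApproxKernel) (M : ℕ) (σ : ℕ → ℝ) {L T : ℝ} [Fact (0 < L)]
    (v : Icc (0 : ℝ) T → Torus L → E3) : Set (SpaceTime L T) :=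
  ⋂ p : ℕ, ⋃ q > p, activeRegion χ η M σ v q

/-- The admissible sequences of thresholds `σ_q`. -/
structure IsThreshold (σ : ℕ → ℝ) : Prop where
  pos : ∀ q, 0 < σ q
  antitone : Antitone σ
  tendsto_zero : Tendsto σ atTop (𝓝 0)
  exponentialType : Tendsto (fun q : ℕ => Real.log (σ q) / q) atTop (𝓝 0)

/-! ### The Onsager singular set -/

/-- `v` is regular on the open set `U`: `ε(vφ) = 0` for all scalar `φ ∈ C_0^∞(U)`. -/
def RegularOn (χ : Cutoff) {L T : ℝ} [Fact (0 < L)] (v : Icc (0 : ℝ) T → Torus L → E3)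
    (U : Set (SpaceTime L T)) : Prop :=
  ∀ φ : ℝ → Torus L → ℝ, SmoothInSpaceTime φ →
    tsupport (fun z : SpaceTime L T => φ z.1 z.2) ⊆ U →
      onsager χ (fun (t : Icc (0 : ℝ) T) x => φ t x • v t x) = 0

/-- The singular set: the complement of the union of the open sets on which `v` is regular. -/
def singularSet (χ : Cutoff) {L T : ℝ} [Fact (0 < L)] (v : Icc (0 : ℝ) T → Torus L → E3) :
    Set (SpaceTime L T) :=
  (⋃₀ {U : Set (SpaceTime L T) | IsOpen U ∧ RegularOn χ v U})ᶜ

end Intermittency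

end

noncomputable section

namespace Intermittency

/-! ### Characters of the torus -/

/-! The concentrating sets are G_q = P_q ∩ W_q, where P_q is the union of the active regions of
index above q and W_q is the 1/(q+1)-neighbourhood of S. They are open and decrease to A ∩ S,
because each active region is open (`WeaklyContinuous.isOpen_activeRegion`) and S is closed. The
complement of G_q is the union of the complements of P_q and W_q, so it suffices that the flux
vanishes in the limit on each of these two sets.

The first step reduces the flux to the blocks: if λ_r⟨|u_r|³ 1_E⟩ → 0, then ⟨|π_q| 1_E⟩ → 0
(`tendsto_flux_of_tendsto_blocks`). In π_q the two undifferentiated factors have index at least q -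
1, the differentiated one has index below q. By Hölder each undifferentiated factor contributes δ
2^(-r/3), with δ small on E. The gradient is estimated on all of space-time by Bernstein's
inequality (`exists_bernstein`) and the finiteness of ε(u), which give C A 2^(2p/3). Both resulting
sums are geometric and balance at index q, leaving K δ² (`exists_flux_bound`). Since the gradient
needs no smallness, its nonlocality does no harm.

Off P_q every block of index r > q is inactive. The mollified cubes form a partition of unity of
multiplicity at most 27, so |u_r| ≤ 27 σ_r⟨|u_r|³⟩/⟨|u_r|²⟩ there. Giving up one of the three powers
of |u_r| yields ⟨|u_r|³ 1_E⟩ ≤ 27 σ_r⟨|u_r|³⟩, and σ_r → 0 (`tendsto_blocks_of_inactive`).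

The complement of W_q is compact and misses S, so finitely many neighbourhoods from
`exists_nhds_tendsto_blocks` cover it. Near a regular point, u = φu + (1-φ)u with a cutoff φ. The
blocks of φu decay by Onsager regularity. Those of (1-φ)u are seen only through the tails of the
Littlewood-Paley kernels, which are O(2^(-r)) away from the diagonal (`exists_block_offDiagonal`).
-/

lemma continuous_character {L : ℝ} (k : Fin 3 → ℤ) :
    Continuous (character k : Torus L → ℂ) := by
  unfold character
  fun_prop

lemma norm_fourier_apply {L : ℝ} (n : ℤ) (x : AddCircle L) : ‖fourier n x‖ = 1 := by
  rw [fourier_apply]; exact Circle.norm_coe _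

lemma norm_character {L : ℝ} (k : Fin 3 → ℤ) (x : Torus L) : ‖character k x‖ = 1 := by
  rw [character, norm_prod]
  exact Finset.prod_eq_one fun i _ => norm_fourier_apply _ _

lemma fourier_apply_add {L : ℝ} (n : ℤ) (x y : AddCircle L) :
    (fourier n (x + y) : ℂ) = fourier n x * fourier n y := by
  simp only [fourier_apply, smul_add, AddCircle.toCircle_add, Circle.coe_mul]

lemma character_apply_add {L : ℝ} (k : Fin 3 → ℤ) (x y : Torus L) :
    character k (x + y) = character k x * character k y := by
  simp only [character, Pi.add_apply, fourier_apply_add, Finset.prod_mul_distrib]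

lemma character_neg {L : ℝ} (k : Fin 3 → ℤ) (x : Torus L) :
    character (-k) x = character k (-x) := by
  simp only [character, Pi.neg_apply, fourier_apply, neg_smul, smul_neg]

lemma character_neg_eq_conj {L : ℝ} (k : Fin 3 → ℤ) (x : Torus L) :
    character (-k) x = (starRingEnd ℂ) (character k x) := by
  simp only [character, Pi.neg_apply, fourier_neg, map_prod]

lemma character_add {L : ℝ} (k l : Fin 3 → ℤ) (x : Torus L) :
    character (k + l) x = character k x * character l x := by
  simp only [character, Pi.add_apply, fourier_add, Finset.prod_mul_distrib]

lemma character_single {L : ℝ} (i : Fin 3) (x : Torus L) :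
    character (Pi.single i 1) x = fourier 1 (x i) := by
  rw [character, Finset.prod_eq_single i]
  · simp
  · intro j _ hj
    simp [Pi.single_eq_of_ne hj]
  · simp

lemma character_toTorus {L : ℝ} (k : Fin 3 → ℤ) (y : E3) :
    character k (toTorus L y) =
      Complex.exp (2 * Real.pi * Complex.I * (∑ i, (k i : ℂ) * (y i : ℂ)) / L) := by
  simp only [character, toTorus, fourier_coe_apply, ← Complex.exp_sum]
  congr 1
  rw [Finset.mul_sum, Finset.sum_div]
  exact Finset.sum_congr rfl fun i _ => by ring

lemma toTorus_surjective (L : ℝ) : Function.Surjective (toTorus L) := by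
  intro x
  choose y hy using fun i => QuotientAddGroup.mk_surjective (x i)
  exact ⟨WithLp.toLp 2 y, funext hy⟩

lemma toTorus_add (L : ℝ) (y z : E3) : toTorus L (y + z) = toTorus L y + toTorus L z := by
  ext i; simp [toTorus]

lemma toTorus_sub (L : ℝ) (y z : E3) : toTorus L (y - z) = toTorus L y - toTorus L z := by
  ext i; simp [toTorus]

lemma continuous_toTorus (L : ℝ) : Continuous (toTorus L) :=
  continuous_pi fun i => (AddCircle.continuous_mk' L).comp (by fun_prop)

/-! ### Blocks as finite sums -/

/-- The integer frequency `k` as a vector of Euclidean space. -/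
def kvec (k : Fin 3 → ℤ) : E3 := WithLp.toLp 2 (fun i => (k i : ℝ))

lemma smul_freq {L : ℝ} (hL : 0 < L) (k : Fin 3 → ℤ) : L • freq L k = kvec k := by
  ext i; simp [freq, kvec, mul_div_cancel₀ _ hL.ne']

lemma Cutoff.eq_zero (χ : Cutoff) {ξ : E3} (h : 1 ≤ ‖ξ‖) : χ.toFun ξ = 0 := by
  by_contra h0
  have := χ.support_subset (subset_tsupport _ h0)
  rw [mem_ball_zero_iff] at this
  linarith

/-- χ vanishes outside the unit ball, and the wider of the two dilates in φ_q is supported in radius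
2^(q+1). The formula also covers q = -1, where the radius is 1. -/
lemma norm_kvec_lt_of_multiplier_ne_zero (χ : Cutoff) {L : ℝ} (hL : 0 < L) {q : ℤ}
    {k : Fin 3 → ℤ} (h : multiplier χ L q (freq L k) ≠ 0) : ‖kvec k‖ < 2 ^ (q + 1) := by
  have h2 : (0 : ℝ) < 2 ^ q := by positivity
  by_contra! hk
  apply h
  have hk' : 2 * 2 ^ q ≤ ‖kvec k‖ := by rwa [zpow_add_one₀ two_ne_zero, mul_comm] at hk
  have e : (L / 2 ^ q) • freq L k = (1 / 2 ^ q : ℝ) • kvec k := by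
    rw [← smul_freq hL, smul_smul]; congr 1; ring
  have n1 : 2 ≤ ‖(1 / 2 ^ q : ℝ) • kvec k‖ := by
    rw [norm_smul, Real.norm_of_nonneg (by positivity), div_mul_eq_mul_div, one_mul,
      le_div_iff₀ h2]
    exact hk'
  unfold multiplier
  split_ifs with h1 h3
  · rfl
  · subst h3
    rw [smul_freq hL]
    exact χ.eq_zero (by norm_num at hk; exact hk)
  · rw [e, χ.eq_zero, χ.eq_zero, sub_zero]
    · linarith
    · rw [norm_smul, Real.norm_of_nonneg (by norm_num)]; linarith

lemma abs_le_norm_kvec (k : Fin 3 → ℤ) (i : Fin 3) : |(k i : ℝ)| ≤ ‖kvec k‖ := by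
  simpa [kvec] using PiLp.norm_apply_le (kvec k) i

/-- The integer frequencies in the cube of side `2 N`. -/
def freqBox (N : ℕ) : Finset (Fin 3 → ℤ) := Fintype.piFinset fun _ => Finset.Icc (-(N : ℤ)) N

lemma mem_freqBox {N : ℕ} {k : Fin 3 → ℤ} : k ∈ freqBox N ↔ ∀ i, |k i| ≤ N := by
  simp [freqBox, Fintype.mem_piFinset, abs_le]

lemma card_freqBox (N : ℕ) : (freqBox N).card = (2 * N + 1) ^ 3 := by
  rw [freqBox, Fintype.card_piFinset]
  simp only [Int.card_Icc, Finset.prod_const, Finset.card_univ, Fintype.card_fin]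
  congr 1; omega

/-- A bound for the frequencies of the block of index `q`. -/
def freqBound (q : ℤ) : ℕ := 2 ^ (q + 1).toNat

lemma zpow_le_freqBound (q : ℤ) : (2 : ℝ) ^ (q + 1) ≤ freqBound q := by
  rw [freqBound]; push_cast
  rw [← zpow_natCast]
  exact zpow_le_zpow_right₀ one_le_two (Int.self_le_toNat _)

lemma multiplier_eq_zero_of_notMem (χ : Cutoff) {L : ℝ} (hL : 0 < L) {q : ℤ}
    {k : Fin 3 → ℤ} (h : k ∉ freqBox (freqBound q)) : multiplier χ L q (freq L k) = 0 := by
  by_contra h0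
  apply h
  rw [mem_freqBox]
  intro i
  have h1 := (abs_le_norm_kvec k i).trans
    ((norm_kvec_lt_of_multiplier_ne_zero χ hL h0).le.trans (zpow_le_freqBound q))
  exact_mod_cast h1

lemma block_apply (χ : Cutoff) {L : ℝ} [hL : Fact (0 < L)] (q : ℤ) (v : Torus L → E3)
    (x : Torus L) (i : Fin 3) :
    block χ q v x i = (∑ k ∈ freqBox (freqBound q),
      (multiplier χ L q (freq L k) : ℂ) * fourierCoef v k i * character k x).re := by
  rw [block]
  simp only
  rw [tsum_eq_sum]
  intro k hk
  rw [multiplier_eq_zero_of_notMem χ hL.out hk]; simp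

lemma integrable_coord {L : ℝ} [Fact (0 < L)] (v : L2Field L) (i : Fin 3) :
    Integrable (fun x => v x i) :=
  (EuclideanSpace.proj (𝕜 := ℝ) i).integrable_comp
    ((Lp.memLp v).integrable one_le_two)

lemma integrable_coord_mul_character {L : ℝ} [Fact (0 < L)] {v : Torus L → ℝ}
    (hv : Integrable v) (k : Fin 3 → ℤ) :
    Integrable (fun x => ((v x : ℝ) : ℂ) * character k x) :=
  hv.ofReal.mul_bdd (c := 1) (continuous_character k).aestronglyMeasurable
    (Eventually.of_forall fun x => (norm_character k x).le)

/-- Weak continuity is tested with the field whose only nonzero component is g; it is bounded, hence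
in L². -/
lemma WeaklyContinuous.continuous_integral {L T : ℝ} [Fact (0 < L)]
    {u : Icc (0 : ℝ) T → L2Field L} (hu : WeaklyContinuous u) (i : Fin 3) {g : Torus L → ℝ}
    (hg : Continuous g) : Continuous (fun t => ∫ x, u t x i * g x) := by
  obtain ⟨C, hC⟩ := isCompact_univ.exists_bound_of_continuousOn hg.continuousOn
  have hW : MemLp (fun x => EuclideanSpace.single i (g x) : Torus L → E3) 2 volume := by
    refine MemLp.of_bound (Continuous.aestronglyMeasurable ?_) C
      (Eventually.of_forall fun x => ?_)
    · have : (fun x => EuclideanSpace.single i (g x) : Torus L → E3) =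
          fun x => g x • EuclideanSpace.single i (1 : ℝ) := by
        ext x j; simp
      rw [this]; fun_prop
    · simpa using hC x trivial
  refine (hu hW.toLp).congr fun t => ?_
  rw [L2.inner_def]
  refine integral_congr_ae ?_
  filter_upwards [hW.coeFn_toLp] with x hx
  rw [hx, EuclideanSpace.inner_single_right]
  simp [mul_comm]

lemma WeaklyContinuous.continuous_fourierCoef {L T : ℝ} [Fact (0 < L)]
    {u : Icc (0 : ℝ) T → L2Field L} (hu : WeaklyContinuous u) (k : Fin 3 → ℤ) (i : Fin 3) :
    Continuous (fun t => fourierCoef (u t) k i) := by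
  unfold fourierCoef
  refine continuous_const.mul ?_
  have h (t) : ∫ x : Torus L, ((u t x i : ℝ) : ℂ) * character (-k) x =
      ((∫ x, u t x i * (character (-k) x).re : ℝ) : ℂ) +
        ((∫ x, u t x i * (character (-k) x).im : ℝ) : ℂ) * Complex.I := by
    rw [← integral_re_add_im (integrable_coord_mul_character (integrable_coord (u t) i) (-k))]
    simp
  simp only [h]
  have hc := continuous_character (L := L) (-k)
  have h1 := hu.continuous_integral i (Complex.continuous_re.comp hc)
  have h2 := hu.continuous_integral i (Complex.continuous_im.comp hc)
  exact (Complex.continuous_ofReal.comp h1).add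
    ((Complex.continuous_ofReal.comp h2).mul continuous_const)

/-- The blocks of a weakly continuous field are jointly continuous in time and space. -/
lemma WeaklyContinuous.continuous_blockST {L T : ℝ} [Fact (0 < L)]
    {u : Icc (0 : ℝ) T → L2Field L} (hu : WeaklyContinuous u) (χ : Cutoff) (q : ℤ) :
    Continuous (blockST χ (fun t => u t) q : SpaceTime L T → E3) := by
  have : blockST χ (fun t => u t) q =
      fun z : SpaceTime L T => WithLp.toLp 2 (fun i => block χ q (u z.1) z.2 i) := rfl
  rw [this]
  simp only [block_apply]
  have h1 := continuous_character (L := L)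
  have h2 := fun k i => hu.continuous_fourierCoef k i
  have h3 (k : Fin 3 → ℤ) (i : Fin 3) :
      Continuous fun z : SpaceTime L T => fourierCoef (u z.1) k i := (h2 k i).comp continuous_fst
  fun_prop

/-! ### Gradients of band-limited functions and Bernstein's inequality -/

open scoped FourierTransform

/-- An integrable kernel whose Fourier transform is `2 π i ξ_i` for `|ξ| ≤ 1 / 2`. -/
lemma exists_derivative_kernel (χ : Cutoff) (i : Fin 3) :
    ∃ g : E3 → ℂ, Continuous g ∧ Integrable g ∧ ∀ ξ : E3, ‖ξ‖ ≤ 1 / 2 →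
      ∫ y, g y * Complex.exp (-(2 * Real.pi * Complex.I * (inner ℝ y ξ : ℝ))) =
        2 * Real.pi * Complex.I * (ξ i : ℝ) := by
  have h1 : HasCompactSupport (fun ξ : E3 =>
      ((χ.toFun ξ : ℝ) : ℂ) * (2 * Real.pi * Complex.I * (ξ i : ℝ))) :=
    (χ.compactSupport.comp_left (g := fun r : ℝ => (r : ℂ)) rfl).mul_right
  have h2 : ContDiff ℝ ∞ (fun ξ : E3 =>
      ((χ.toFun ξ : ℝ) : ℂ) * (2 * Real.pi * Complex.I * (ξ i : ℝ))) := by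
    have a := Complex.ofRealCLM.contDiff.comp χ.smooth
    have b : ContDiff ℝ ∞ (fun ξ : E3 => ((ξ i : ℝ) : ℂ)) :=
      Complex.ofRealCLM.contDiff.comp (EuclideanSpace.proj (𝕜 := ℝ) i).contDiff
    exact a.mul (contDiff_const.mul b)
  -- Cutting the symbol off by χ makes it a Schwartz function without changing it where χ = 1; the
  -- kernel is its inverse Fourier transform.
  set G := h1.toSchwartzMap h2 with hG
  set g : SchwartzMap E3 ℂ := 𝓕⁻ G with hg
  refine ⟨g, g.continuous, g.integrable, fun ξ hξ => ?_⟩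
  have h3 : (𝓕 g) ξ = G ξ := by rw [hg, FourierTransform.fourier_fourierInv_eq]
  rw [SchwartzMap.fourier_coe, Real.fourier_eq'] at h3
  have h4 : G ξ = ((χ.toFun ξ : ℝ) : ℂ) * (2 * Real.pi * Complex.I * (ξ i : ℝ)) := rfl
  rw [h4, χ.eq_one ξ hξ] at h3
  rw [← one_mul (2 * Real.pi * Complex.I * (ξ i : ℝ)), ← Complex.ofReal_one, ← h3]
  refine integral_congr_ae (Eventually.of_forall fun y => ?_)
  simp only [smul_eq_mul]
  rw [mul_comm]
  congr 2
  push_cast; ring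

lemma hasDerivAt_character {L : ℝ} (k : Fin 3 → ℤ) (i : Fin 3) (x : Torus L) :
    HasDerivAt (fun s : ℝ => character k (x + Pi.single i (s : AddCircle L)))
      (character k x * (2 * Real.pi * Complex.I * k i / L)) 0 := by
  have h (s : ℝ) : character k (x + Pi.single i (s : AddCircle L)) =
      character k x * Complex.exp (2 * Real.pi * Complex.I * k i / L * (s : ℂ)) := by
    rw [character_apply_add]
    congr 1
    have : (Pi.single i (s : AddCircle L) : Torus L) = toTorus L (EuclideanSpace.single i s) := by
      ext j
      by_cases hj : j = i
      · subst hj; simp [toTorus]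
      · simp [toTorus, hj]
    rw [this, character_toTorus]
    congr 1
    rw [Finset.sum_eq_single i]
    · simp; ring
    · intro j _ hj; simp [hj]
    · simp
  simp only [h]
  have h1 : HasDerivAt (fun s : ℝ => Complex.exp (2 * Real.pi * Complex.I * k i / L * (s : ℂ)))
      (Complex.exp (2 * Real.pi * Complex.I * k i / L * ((0 : ℝ) : ℂ)) *
        (2 * Real.pi * Complex.I * k i / L * 1)) 0 :=
    ((Complex.ofRealCLM.hasDerivAt (x := (0 : ℝ))).const_mul _).cexp
  simpa using h1.const_mul (character k x)

/-- Trigonometric polynomials on the torus with frequencies at most `R`. -/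
def trigPoly (L R : ℝ) : Submodule ℂ (Torus L → ℂ) :=
  Submodule.span ℂ {W | ∃ k : Fin 3 → ℤ, ‖kvec k‖ ≤ R ∧ W = character k}

lemma continuous_of_mem_trigPoly {L R : ℝ} {W : Torus L → ℂ} (hW : W ∈ trigPoly L R) :
    Continuous W := by
  induction hW using Submodule.span_induction with
  | mem W h => obtain ⟨k, _, rfl⟩ := h; exact continuous_character k
  | zero => exact continuous_const
  | add W₁ W₂ _ _ h₁ h₂ => exact h₁.add h₂
  | smul a W _ h => exact continuous_const.mul h

lemma integrable_kernel_mul {L : ℝ} [Fact (0 < L)] {g : E3 → ℂ} (hg : Integrable g)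
    {W : Torus L → ℂ} (hW : Continuous W) (x : Torus L) (a : ℝ) :
    Integrable (fun y => g y * W (x - toTorus L (a • y))) := by
  obtain ⟨C, hC⟩ := isCompact_univ.exists_bound_of_continuousOn hW.continuousOn
  refine hg.mul_bdd (c := C) (Continuous.aestronglyMeasurable ?_)
    (Eventually.of_forall fun x => hC _ trivial)
  have := continuous_toTorus L
  fun_prop

/-- On a character the integral is the symbol 2πiξ_i at ξ = k/N, which lies in the ball |ξ| ≤ 1/2
where the kernel reproduces it; the factor N/L restores the eigenvalue 2πik_i/L. Both sides are
linear, so the identity extends to the span. -/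
lemma hasDerivAt_trigPoly {L : ℝ} [hL : Fact (0 < L)] {N : ℝ} (hN : 0 < N) {i : Fin 3}
    {g : E3 → ℂ} (hg : Integrable g) (hg' : ∀ ξ : E3, ‖ξ‖ ≤ 1 / 2 →
      ∫ y, g y * Complex.exp (-(2 * Real.pi * Complex.I * (inner ℝ y ξ : ℝ))) =
        2 * Real.pi * Complex.I * (ξ i : ℝ))
    {W : Torus L → ℂ} (hW : W ∈ trigPoly L (N / 2)) (x : Torus L) :
    HasDerivAt (fun s : ℝ => W (x + Pi.single i (s : AddCircle L)))
      (((N / L : ℝ) : ℂ) * ∫ y, g y * W (x - toTorus L ((L / N) • y))) 0 := by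
  have hL' := hL.out
  induction hW using Submodule.span_induction with
  | mem W h =>
    obtain ⟨k, hk, rfl⟩ := h
    convert hasDerivAt_character k i x using 1
    have h1 := hg' (N⁻¹ • kvec k) (by
      rw [norm_smul, norm_inv, Real.norm_of_nonneg hN.le, inv_mul_le_iff₀ hN]; linarith)
    have h2 : ∀ y : E3, g y * character k (x - toTorus L ((L / N) • y)) = character k x *
        (g y * Complex.exp (-(2 * Real.pi * Complex.I * (inner ℝ y (N⁻¹ • kvec k) : ℝ)))) := by
      intro y
      rw [sub_eq_add_neg, character_apply_add, ← character_neg, character_toTorus]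
      have : 2 * Real.pi * Complex.I *
          (∑ j, ((-k) j : ℂ) * (((L / N) • y) j : ℂ)) / L =
          -(2 * Real.pi * Complex.I * (inner ℝ y (N⁻¹ • kvec k) : ℝ)) := by
        have hL0 : (L : ℂ) ≠ 0 := by exact_mod_cast hL'.ne'
        rw [PiLp.inner_apply]
        simp only [kvec, PiLp.smul_apply, smul_eq_mul, Pi.neg_apply, Fin.sum_univ_three]
        simp
        field_simp
        ring
      rw [← this]
      push_cast
      ring
    simp only [h2]
    rw [integral_const_mul, h1]
    have hL0 : (L : ℂ) ≠ 0 := by exact_mod_cast hL'.ne'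
    have hN0 : (N : ℂ) ≠ 0 := by exact_mod_cast hN.ne'
    simp [kvec]
    field_simp
  | zero => simpa using hasDerivAt_const (0 : ℝ) (0 : ℂ)
  | add W₁ W₂ m₁ m₂ h₁ h₂ =>
    have := h₁.add h₂
    rw [← mul_add, ← integral_add
      (integrable_kernel_mul hg (continuous_of_mem_trigPoly m₁) x _)
      (integrable_kernel_mul hg (continuous_of_mem_trigPoly m₂) x _)] at this
    simp only [← mul_add] at this
    exact this
  | smul a W m h =>
    have := h.const_mul a
    rw [mul_left_comm, ← integral_const_mul] at this
    simp only [mul_left_comm a] at this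
    exact this

lemma kvec_neg (k : Fin 3 → ℤ) : kvec (-k) = -kvec k := by
  ext i; simp [kvec]

/-- Taking the real part pairs k with -k, which does not change the length of the frequency. -/
lemma block_mem_trigPoly (χ : Cutoff) {L : ℝ} [hL : Fact (0 < L)] (q : ℤ) (v : Torus L → E3)
    (j : Fin 3) :
    (fun x => ((block χ q v x j : ℝ) : ℂ)) ∈ trigPoly L (2 ^ (q + 1)) := by
  have h : (fun x => ((block χ q v x j : ℝ) : ℂ)) =
      ∑ k ∈ freqBox (freqBound q),
        (((1 / 2 * (multiplier χ L q (freq L k) : ℂ) * fourierCoef v k j : ℂ)) •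
            (character k : Torus L → ℂ) +
          (1 / 2 * (multiplier χ L q (freq L k) : ℂ) * (starRingEnd ℂ) (fourierCoef v k j) : ℂ) •
            (character (-k) : Torus L → ℂ)) := by
    ext x
    rw [block_apply, Complex.re_eq_add_conj, map_sum, Finset.sum_apply, ← Finset.sum_add_distrib,
      Finset.sum_div]
    refine Finset.sum_congr rfl fun k _ => ?_
    simp only [map_mul, Complex.conj_ofReal, Pi.add_apply, Pi.smul_apply, smul_eq_mul,
      character_neg_eq_conj]
    ring
  rw [h]
  refine Submodule.sum_mem _ fun k _ => ?_
  by_cases hk : multiplier χ L q (freq L k) = 0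
  · simp [hk]
  · have := (norm_kvec_lt_of_multiplier_ne_zero χ hL.out hk).le
    exact Submodule.add_mem _
      (Submodule.smul_mem _ _ (Submodule.subset_span ⟨k, this, rfl⟩))
      (Submodule.smul_mem _ _ (Submodule.subset_span ⟨-k, by rwa [kvec_neg, norm_neg], rfl⟩))

/-- Reproducing formula for the gradient of a block, as a pointwise bound. -/
lemma enorm_pderiv_block_le (χ : Cutoff) {L : ℝ} [hL : Fact (0 < L)] {i : Fin 3}
    {g : E3 → ℂ} (hg : Integrable g) (hg' : ∀ ξ : E3, ‖ξ‖ ≤ 1 / 2 →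
      ∫ y, g y * Complex.exp (-(2 * Real.pi * Complex.I * (inner ℝ y ξ : ℝ))) =
        2 * Real.pi * Complex.I * (ξ i : ℝ))
    (q : ℤ) (v : Torus L → E3) (x : Torus L) (j : Fin 3) :
    ‖pderiv i (block χ q v) x j‖ₑ ≤ ENNReal.ofReal (2 ^ (q + 2) / L) *
      ∫⁻ y, ‖g y‖ₑ * ‖block χ q v (x - toTorus L ((L / 2 ^ (q + 2)) • y))‖ₑ := by
  -- N = 2^(q+2) makes N/2 equal to the frequency bound 2^(q+1) of the block.
  have hN : (0 : ℝ) < 2 ^ (q + 2) := by positivity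
  have hmem (j : Fin 3) :
      (fun x => ((block χ q v x j : ℝ) : ℂ)) ∈ trigPoly L (2 ^ (q + 2) / 2) := by
    have : (2 : ℝ) ^ (q + 2) / 2 = 2 ^ (q + 1) := by
      rw [show q + 2 = q + 1 + 1 by ring, zpow_add_one₀ two_ne_zero]; simp
    rw [this]; exact block_mem_trigPoly χ q v j
  have hd (j : Fin 3) := (hasDerivAt_trigPoly hN hg hg' (hmem j) x)
  have hd' (j : Fin 3) := Complex.reCLM.hasFDerivAt.comp_hasDerivAt 0 (hd j)
  have hd'' := (EuclideanSpace.equiv (Fin 3) ℝ).symm.toContinuousLinearMap.hasFDerivAt.comp_hasDerivAt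
    0 (hasDerivAt_pi.2 hd')
  have e : pderiv i (block χ q v) x j = Complex.reCLM (((2 ^ (q + 2) / L : ℝ) : ℂ) *
      ∫ y, g y * ((block χ q v (x - toTorus L ((L / 2 ^ (q + 2)) • y)) j : ℝ) : ℂ)) :=
    congrArg (fun w : E3 => w j) hd''.deriv
  rw [e]
  have h1 : ∀ z : ℂ, ‖Complex.reCLM z‖ₑ ≤ ‖z‖ₑ := fun z => by
    rw [← ofReal_norm, ← ofReal_norm]
    exact ENNReal.ofReal_le_ofReal (Complex.abs_re_le_norm z)
  refine (h1 _).trans ?_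
  rw [enorm_mul]
  have h2 : ‖((2 ^ (q + 2) / L : ℝ) : ℂ)‖ₑ = ENNReal.ofReal (2 ^ (q + 2) / L) := by
    rw [← ofReal_norm, Complex.norm_real,
      Real.norm_of_nonneg (div_nonneg hN.le hL.out.le)]
  rw [h2]
  gcongr
  refine (enorm_integral_le_lintegral_enorm _).trans (lintegral_mono fun y => ?_)
  rw [enorm_mul]
  gcongr
  rw [← ofReal_norm, ← ofReal_norm, Complex.norm_real]
  exact ENNReal.ofReal_le_ofReal (PiLp.norm_apply_le _ j)

/-- Jensen's inequality for cubes of averages against an integrable kernel. -/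
lemma lintegral_kernel_cube_le {Y Z : Type*} [MeasurableSpace Y] [MeasurableSpace Z]
    {ν : Measure Y} {μ : Measure Z} [SFinite ν] [SFinite μ] {k : Y → ℝ≥0∞} (hk : Measurable k)
    {F : Z → Y → ℝ≥0∞} (hF : Measurable (Function.uncurry F)) {A : ℝ≥0∞}
    (hA : ∀ y, ∫⁻ z, F z y ^ 3 ∂μ ≤ A) :
    ∫⁻ z, (∫⁻ y, k y * F z y ∂ν) ^ 3 ∂μ ≤ (∫⁻ y, k y ∂ν) ^ 3 * A := by
  have hz (z : Z) : (∫⁻ y, k y * F z y ∂ν) ^ 3 ≤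
      (∫⁻ y, k y ∂ν) ^ 2 * ∫⁻ y, k y * F z y ^ 3 ∂ν := by
    have hFz : Measurable (F z) := hF.comp measurable_prodMk_left
    -- Hölder with exponents 3/2 and 3 for the splitting k F = k^(2/3) (k F³)^(1/3).
    have h := ENNReal.lintegral_mul_norm_pow_le (μ := ν) (f := k) (g := fun y => k y * F z y ^ 3)
      hk.aemeasurable (hk.mul (hFz.pow_const 3)).aemeasurable (p := 2 / 3) (q := 1 / 3)
      (by norm_num) (by norm_num) (by norm_num)
    have e (y : Y) : k y * F z y = k y ^ (2 / 3 : ℝ) * (k y * F z y ^ 3) ^ (1 / 3 : ℝ) := by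
      rw [ENNReal.mul_rpow_of_nonneg _ _ (by norm_num), ← mul_assoc,
        ← ENNReal.rpow_add_of_nonneg _ _ (by norm_num) (by norm_num), ← ENNReal.rpow_natCast,
        ← ENNReal.rpow_mul]
      norm_num
    simp only [← e] at h
    calc (∫⁻ y, k y * F z y ∂ν) ^ 3 ≤ _ := pow_le_pow_left' h 3
      _ = _ := by
        rw [mul_pow, ← ENNReal.rpow_natCast, ← ENNReal.rpow_natCast, ← ENNReal.rpow_mul,
          ← ENNReal.rpow_mul, ← ENNReal.rpow_natCast]
        norm_num
  calc ∫⁻ z, (∫⁻ y, k y * F z y ∂ν) ^ 3 ∂μ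
      ≤ ∫⁻ z, (∫⁻ y, k y ∂ν) ^ 2 * ∫⁻ y, k y * F z y ^ 3 ∂ν ∂μ := lintegral_mono hz
    _ = (∫⁻ y, k y ∂ν) ^ 2 * ∫⁻ z, ∫⁻ y, k y * F z y ^ 3 ∂ν ∂μ := by
        rw [lintegral_const_mul]
        exact Measurable.lintegral_prod_right
          ((hk.comp measurable_snd).mul (hF.pow_const 3))
    _ = (∫⁻ y, k y ∂ν) ^ 2 * ∫⁻ y, k y * ∫⁻ z, F z y ^ 3 ∂μ ∂ν := by
        rw [lintegral_lintegral_swap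
          ((hk.comp measurable_snd).mul (hF.pow_const 3)).aemeasurable]
        congr 1
        refine lintegral_congr fun y => ?_
        rw [lintegral_const_mul]
        exact (hF.comp measurable_prodMk_right).pow_const 3
    _ ≤ (∫⁻ y, k y ∂ν) ^ 2 * ∫⁻ y, k y * A ∂ν := by
        gcongr with y
        exact hA y
    _ = _ := by
        rw [lintegral_mul_const _ hk]; ring

/-! ### Space-time averages -/

/-- The normalized Lebesgue measure on space-time. -/
def avgMeasure (L T : ℝ) [Fact (0 < L)] : Measure (SpaceTime L T) :=
  (volume (univ : Set (SpaceTime L T)))⁻¹ • volume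

lemma avgPow_eq {L T : ℝ} [Fact (0 < L)] {F : Type*} [NormedAddCommGroup F] (r : ℕ)
    (g : SpaceTime L T → F) : avgPow r g = ∫⁻ z, ‖g z‖ₑ ^ r ∂avgMeasure L T := rfl

instance isFiniteMeasure_time (T : ℝ) : IsFiniteMeasure (volume : Measure (Icc (0 : ℝ) T)) :=
  ⟨by rw [Measure.Subtype.volume_univ nullMeasurableSet_Icc]; simp⟩

lemma volume_spaceTime_ne_zero {L T : ℝ} [hL : Fact (0 < L)] (hT : 0 < T) :
    (volume : Measure (SpaceTime L T)) univ ≠ 0 := by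
  rw [Measure.volume_eq_prod, ← univ_prod_univ, Measure.prod_prod]
  refine mul_ne_zero ?_ ?_
  · rw [Measure.Subtype.volume_univ nullMeasurableSet_Icc]; simpa using hT
  · rw [volume_pi, Measure.pi_univ]
    simpa [AddCircle.measure_univ] using hL.out

lemma isProbabilityMeasure_avgMeasure {L T : ℝ} [hL : Fact (0 < L)] (hT : 0 < T) :
    IsProbabilityMeasure (avgMeasure L T) :=
  ⟨by
    rw [avgMeasure, Measure.smul_apply, smul_eq_mul]
    exact ENNReal.inv_mul_cancel (volume_spaceTime_ne_zero hT) (measure_ne_top _ _)⟩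

/-- Translation invariance in space: it makes the L³ norm of a translated block independent of the
translation, as `lintegral_kernel_cube_le` requires. -/
lemma lintegral_avgMeasure_translate {L T : ℝ} [Fact (0 < L)] (a : Torus L)
    {F : SpaceTime L T → ℝ≥0∞} (hF : Measurable F) :
    ∫⁻ z, F (z.1, z.2 - a) ∂avgMeasure L T = ∫⁻ z, F z ∂avgMeasure L T := by
  have h : MeasurePreserving (Prod.map id fun x => x - a) (volume : Measure (SpaceTime L T))
      volume :=
    (MeasurePreserving.id _).prod (measurePreserving_sub_right volume a)
  rw [avgMeasure, lintegral_smul_measure, lintegral_smul_measure]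
  congr 1
  exact h.lintegral_comp hF

/-- Bernstein's inequality for the gradients of the blocks. -/
lemma exists_bernstein (χ : Cutoff) {L T : ℝ} [hL : Fact (0 < L)] (hT : 0 < T)
    {u : Icc (0 : ℝ) T → L2Field L} (hu : WeaklyContinuous u) :
    ∃ C : ℝ, 0 ≤ C ∧ ∀ p : ℤ, ∃ D : SpaceTime L T → ℝ≥0∞, Measurable D ∧
      (∀ z i j, ‖pderiv i (block χ p (u z.1)) z.2 j‖ₑ ≤ D z) ∧
      ∫⁻ z, D z ^ 3 ∂avgMeasure L T ≤
        ENNReal.ofReal (C * 2 ^ p) ^ 3 * avgPow 3 (blockST χ (fun t => u t) p : SpaceTime L T → E3) := by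
  have := isProbabilityMeasure_avgMeasure (L := L) hT
  choose g hgc hgi hg using exists_derivative_kernel χ
  -- Summing the three kernels gives one majorant for all partial derivatives.
  set k : E3 → ℝ≥0∞ := fun y => ∑ i, ‖g i y‖ₑ with hk
  have hkm : Measurable k :=
    Finset.measurable_sum _ fun i _ => (hgc i).measurable.enorm
  have hkfin : ∫⁻ y, k y ≠ ⊤ := by
    rw [hk, lintegral_finsetSum _ fun i _ => (hgc i).measurable.enorm]
    exact (ENNReal.sum_lt_top.2 fun i _ => (hgi i).2).ne
  refine ⟨4 / L * (∫⁻ y, k y).toReal, by have := hL.out; positivity, fun p => ?_⟩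
  have hbc := hu.continuous_blockST χ p
  set F : SpaceTime L T → E3 → ℝ≥0∞ := fun z y =>
    ‖blockST χ (fun t => u t) p (z.1, z.2 - toTorus L ((L / 2 ^ (p + 2)) • y))‖ₑ with hFdef
  have hF : Measurable (Function.uncurry F) := by
    have h1 := continuous_toTorus L
    have : Continuous fun w : SpaceTime L T × E3 =>
        ((w.1.1, w.1.2 - toTorus L ((L / 2 ^ (p + 2)) • w.2)) : SpaceTime L T) := by fun_prop
    exact (hbc.comp this).measurable.enorm
  have hkF : Measurable fun z => ∫⁻ y, k y * F z y :=
    Measurable.lintegral_prod_right ((hkm.comp measurable_snd).mul hF)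
  refine ⟨fun z => ENNReal.ofReal (2 ^ (p + 2) / L) * ∫⁻ y, k y * F z y, hkF.const_mul _,
    fun z i j => ?_, ?_⟩
  · refine (enorm_pderiv_block_le χ (hgi i) (hg i) p (u z.1) z.2 j).trans ?_
    exact mul_le_mul' le_rfl (lintegral_mono fun y => mul_le_mul'
      (Finset.single_le_sum (f := fun i => ‖g i y‖ₑ) (fun _ _ => zero_le) (Finset.mem_univ i))
      le_rfl)
  · have h1 := lintegral_kernel_cube_le (μ := avgMeasure L T) (ν := (volume : Measure E3)) hkm hF
      (A := avgPow 3 (blockST χ (fun t => u t) p : SpaceTime L T → E3)) (fun y => by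
        rw [avgPow_eq]
        exact (lintegral_avgMeasure_translate (toTorus L ((L / 2 ^ (p + 2)) • y))
          (hbc.measurable.enorm.pow_const 3)).le)
    simp only [mul_pow]
    rw [lintegral_const_mul _ (hkF.pow_const 3)]
    refine (mul_le_mul_right h1 _).trans (le_of_eq ?_)
    rw [← mul_assoc, ← mul_pow]
    congr 2
    rw [show (2 : ℝ) ^ (p + 2) / L = 4 / L * 2 ^ p by
      rw [zpow_add₀ two_ne_zero]; norm_num; ring, mul_right_comm,
      ENNReal.ofReal_mul (p := 4 / L * 2 ^ p) (by have := hL.out; positivity), ENNReal.ofReal_toReal hkfin]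

/-! ### The flux bound -/

lemma enorm_contractGrad_le {L : ℝ} (a b : E3) (v : Torus L → E3) (x : Torus L) {D : ℝ≥0∞}
    (hD : ∀ i j, ‖pderiv i v x j‖ₑ ≤ D) : ‖contractGrad a b v x‖ₑ ≤ 9 * (‖a‖ₑ * ‖b‖ₑ * D) := by
  have hc (w : E3) (i : Fin 3) : ‖w i‖ₑ ≤ ‖w‖ₑ := by
    rw [← ofReal_norm, ← ofReal_norm]
    exact ENNReal.ofReal_le_ofReal (PiLp.norm_apply_le w i)
  calc ‖contractGrad a b v x‖ₑ ≤ ∑ i : Fin 3, ∑ j : Fin 3, ‖a‖ₑ * ‖b‖ₑ * D := by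
        refine (enorm_sum_le _ _).trans (Finset.sum_le_sum fun i _ => ?_)
        refine (enorm_sum_le _ _).trans (Finset.sum_le_sum fun j _ => ?_)
        rw [enorm_mul, enorm_mul]
        exact mul_le_mul' (mul_le_mul' (hc a i) (hc b j)) (hD i j)
    _ = _ := by
        simp only [Finset.sum_const, Finset.card_univ, Fintype.card_fin, nsmul_eq_mul]
        rw [← mul_assoc]; norm_num

/-- Hölder with three exponents equal to 3; the bounds are phrased with cubes so that no roots
appear later. -/
lemma lintegral_mul_mul_le {Z : Type*} [MeasurableSpace Z] {μ : Measure Z}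
    {f g h : Z → ℝ≥0∞} (hf : AEMeasurable f μ) (hg : AEMeasurable g μ) (hh : AEMeasurable h μ)
    {a b c : ℝ≥0∞} (ha : ∫⁻ z, f z ^ 3 ∂μ ≤ a ^ 3) (hb : ∫⁻ z, g z ^ 3 ∂μ ≤ b ^ 3)
    (hc : ∫⁻ z, h z ^ 3 ∂μ ≤ c ^ 3) : ∫⁻ z, f z * g z * h z ∂μ ≤ a * b * c := by
  have e (x : ℝ≥0∞) : (x ^ 3) ^ (1 / 3 : ℝ) = x := by
    rw [← ENNReal.rpow_natCast, ← ENNReal.rpow_mul]; norm_num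
  have H := ENNReal.lintegral_prod_norm_pow_le (μ := μ) (Finset.univ : Finset (Fin 3))
    (f := ![fun z => f z ^ 3, fun z => g z ^ 3, fun z => h z ^ 3]) (p := fun _ => 1 / 3)
    (by intro i _; fin_cases i
        · exact hf.pow_const 3
        · exact hg.pow_const 3
        · exact hh.pow_const 3) (by norm_num) (by norm_num)
  simp only [Fin.prod_univ_three, Matrix.cons_val_zero, Matrix.cons_val_one, Matrix.cons_val,
    e] at H
  refine H.trans (mul_le_mul' (mul_le_mul' ?_ ?_) ?_)
  · exact (ENNReal.rpow_le_rpow ha (by norm_num)).trans_eq (e a)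
  · exact (ENNReal.rpow_le_rpow hb (by norm_num)).trans_eq (e b)
  · exact (ENNReal.rpow_le_rpow hc (by norm_num)).trans_eq (e c)

/-- A real number `ρ > 1` with `ρ ^ 3 = 2`. -/
lemma exists_cube_root_two : ∃ ρ : ℝ, 1 < ρ ∧ ρ ^ 3 = 2 :=
  ⟨2 ^ (1 / 3 : ℝ), Real.one_lt_rpow one_lt_two (by norm_num), by
    rw [← Real.rpow_natCast, ← Real.rpow_mul (by norm_num)]; norm_num⟩

lemma sum_zpow_le {s : ℝ} (hs : 1 < s) (q : ℕ) :
    ∑ p ∈ Finset.Ico (-1 : ℤ) q, s ^ p ≤ s ^ (q : ℤ) / (s - 1) := by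
  have h1 : 0 < s - 1 := by linarith
  have h0 : s ≠ 0 := by linarith
  induction q with
  -- The sum is the single term of index -1, and s⁻¹ ≤ (s - 1)⁻¹.
  | zero =>
    rw [show Finset.Ico (-1 : ℤ) ((0 : ℕ) : ℤ) = {-1} by rfl]
    simp only [Finset.sum_singleton, zpow_neg_one, Nat.cast_zero, zpow_zero]
    rw [one_div]
    exact inv_anti₀ h1 (by linarith)
  | succ n ih =>
    have : Finset.Ico (-1 : ℤ) ((n + 1 : ℕ) : ℤ) = insert (n : ℤ) (Finset.Ico (-1 : ℤ) n) := by
      ext x; simp only [Finset.mem_insert, Finset.mem_Ico]; omega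
    rw [this, Finset.sum_insert (by simp)]
    push_cast
    rw [zpow_add_one₀ h0]
    calc s ^ (n : ℤ) + _ ≤ s ^ (n : ℤ) + s ^ (n : ℤ) / (s - 1) := by gcongr
      _ = _ := by field_simp; ring

/-- Bound for the flux on `E` if the blocks of index `≥ q - 1` are small on `E`. -/
lemma exists_flux_bound (χ : Cutoff) {L T : ℝ} [hL : Fact (0 < L)] (hT : 0 < T)
    {u : Icc (0 : ℝ) T → L2Field L} (hu : WeaklyContinuous u) {A : ℝ} (hA0 : 0 ≤ A)
    (hA : ∀ p : ℤ, -1 ≤ p →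
      avgPow 3 (blockST χ (fun t => u t) p : SpaceTime L T → E3) ≤
        ENNReal.ofReal (A ^ 3 * 2 ^ (-p))) :
    ∃ K : ℝ, ∀ (E : Set (SpaceTime L T)) (δ : ℝ) (q : ℕ), 0 ≤ δ →
      (∀ r : ℤ, (q : ℤ) - 1 ≤ r →
        ∫⁻ z in E, ‖blockST χ (fun t => u t) r z‖ₑ ^ 3 ∂avgMeasure L T ≤
          ENNReal.ofReal (δ ^ 3 * 2 ^ (-r))) →
      ∫⁻ z in E, ‖fluxDensity χ (fun t => u t) q z‖ₑ ∂avgMeasure L T ≤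
        ENNReal.ofReal (K * δ ^ 2) := by
  obtain ⟨C, hC0, hC⟩ := exists_bernstein χ hT hu
  choose D hDm hDp hDi using hC
  obtain ⟨ρ, hρ1, hρ3⟩ := exists_cube_root_two
  have hρ0 : 0 < ρ := by linarith
  have hρne : ρ ≠ 0 := hρ0.ne'
  have hs : 1 < ρ ^ 2 := one_lt_pow₀ hρ1 two_ne_zero
  have hs1 : 0 < ρ ^ 2 - 1 := by linarith
  -- With ρ³ = 2 the fractional powers 2^(p/3) become the integer powers ρ^p.
  have h2p (p : ℤ) : (2 : ℝ) ^ p = (ρ ^ p) ^ 3 := by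
    rw [← hρ3, ← zpow_natCast, ← zpow_natCast, ← zpow_mul, ← zpow_mul, mul_comm]
  set U : ℤ → SpaceTime L T → E3 := fun p => blockST χ (fun t => u t) p with hU
  have hUm (p : ℤ) : Measurable fun z => ‖U p z‖ₑ :=
    (hu.continuous_blockST χ p).measurable.enorm
  -- the constants of the geometric series
  set c : ℝ := 9 * C * A / (ρ ^ 2 - 1) * ρ ^ 3 with hc
  have hc0 : 0 ≤ c := by positivity
  have hr0 : 0 ≤ (ρ ^ 2)⁻¹ := by positivity
  have hr1 : (ρ ^ 2)⁻¹ < 1 := inv_lt_one_of_one_lt₀ hs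
  refine ⟨3 * c * (1 - (ρ ^ 2)⁻¹)⁻¹, fun E δ q hδ hE => ?_⟩
  -- The restriction to E is dropped for the gradient: A³ 2^(-p) and the Bernstein factor (C 2^p)³
  -- combine to (C A 2^(2p/3))³.
  have hDc (p : ℤ) (hp : -1 ≤ p) : ∫⁻ z in E, D p z ^ 3 ∂avgMeasure L T ≤
      ENNReal.ofReal (C * A * (ρ ^ 2) ^ p) ^ 3 := by
    refine (setLIntegral_le_lintegral _ _).trans ((hDi p).trans ?_)
    refine (mul_le_mul' le_rfl (hA p hp)).trans (le_of_eq ?_)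
    rw [← ENNReal.ofReal_pow (by positivity), ← ENNReal.ofReal_mul (by positivity),
      ← ENNReal.ofReal_pow (by positivity)]
    congr 1
    have e : (ρ ^ 2) ^ p = (ρ ^ p) ^ 2 := by
      rw [← zpow_natCast, ← zpow_natCast, ← zpow_mul, ← zpow_mul, mul_comm]
    rw [h2p, h2p, zpow_neg, e]
    have : ρ ^ p ≠ 0 := by positivity
    field_simp
  have hUc (r : ℤ) (hr : (q : ℤ) - 1 ≤ r) : ∫⁻ z in E, ‖U r z‖ₑ ^ 3 ∂avgMeasure L T ≤
      ENNReal.ofReal (δ * ρ ^ (-r)) ^ 3 := by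
    refine (hE r hr).trans (le_of_eq ?_)
    rw [h2p, ← ENNReal.ofReal_pow (by positivity), mul_pow]
  -- the pointwise bound
  set Φ : ℤ × ℤ → SpaceTime L T → ℝ≥0∞ := fun P z =>
    if (q : ℤ) - 1 ≤ P.1 ∧ (q : ℤ) ≤ P.2 ∧ |P.1 - P.2| < 2 then
      ∑ p ∈ Finset.Ico (-1 : ℤ) q, 9 * (‖U P.1 z‖ₑ * ‖U P.2 z‖ₑ * D p z) else 0 with hΦ
  have hm' (P : ℤ × ℤ) (p : ℤ) : Measurable fun z => ‖U P.1 z‖ₑ * ‖U P.2 z‖ₑ * D p z :=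
    ((hUm P.1).mul (hUm P.2)).mul (hDm p)
  have hm (P : ℤ × ℤ) (p : ℤ) :
      Measurable fun z => 9 * (‖U P.1 z‖ₑ * ‖U P.2 z‖ₑ * D p z) := (hm' P p).const_mul 9
  have hΦm (P : ℤ × ℤ) : Measurable (Φ P) := by
    by_cases h : (q : ℤ) - 1 ≤ P.1 ∧ (q : ℤ) ≤ P.2 ∧ |P.1 - P.2| < 2
    · simp only [hΦ, if_pos h]
      exact Finset.measurable_sum _ fun p _ => hm P p
    · simp only [hΦ, if_neg h]; exact measurable_const
  have hpt (z : SpaceTime L T) : ‖fluxDensity χ (fun t => u t) q z‖ₑ ≤ ∑' P, Φ P z := by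
    refine enorm_tsum_le_tsum_enorm.trans (ENNReal.tsum_le_tsum fun P => ?_)
    simp only [hΦ]
    split_ifs with h
    · refine (enorm_sum_le _ _).trans (Finset.sum_le_sum fun p _ => ?_)
      exact enorm_contractGrad_le _ _ _ _ (hDp p z)
    · simp
  have hint (P : ℤ × ℤ) (h : (q : ℤ) - 1 ≤ P.1 ∧ (q : ℤ) ≤ P.2 ∧ |P.1 - P.2| < 2) :
      ∫⁻ z in E, Φ P z ∂avgMeasure L T ≤
        ENNReal.ofReal (δ ^ 2 * (9 * C * A / (ρ ^ 2 - 1)) * ρ ^ (2 * (q : ℤ) - P.1 - P.2)) := by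
    simp only [hΦ, if_pos h]
    rw [lintegral_finsetSum _ fun p _ => hm P p]
    have h1 (p : ℤ) (hp : p ∈ Finset.Ico (-1 : ℤ) q) :
        ∫⁻ z in E, 9 * (‖U P.1 z‖ₑ * ‖U P.2 z‖ₑ * D p z) ∂avgMeasure L T ≤
          ENNReal.ofReal (9 * (δ * ρ ^ (-P.1) * (δ * ρ ^ (-P.2)) * (C * A * (ρ ^ 2) ^ p))) := by
      rw [lintegral_const_mul _ (hm' P p),
        ENNReal.ofReal_mul (by norm_num), ENNReal.ofReal_mul (by positivity),
        ENNReal.ofReal_mul (p := δ * ρ ^ (-P.1)) (by positivity)]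
      refine mul_le_mul' (by norm_num) ?_
      exact lintegral_mul_mul_le (hUm _).aemeasurable (hUm _).aemeasurable (hDm p).aemeasurable
        (hUc _ h.1) (hUc _ (by linarith [h.2.1])) (hDc p (Finset.mem_Ico.1 hp).1)
    refine (Finset.sum_le_sum h1).trans ?_
    rw [← ENNReal.ofReal_sum_of_nonneg fun p _ => by positivity]
    refine ENNReal.ofReal_le_ofReal ?_
    simp only [← Finset.mul_sum]
    refine (mul_le_mul_of_nonneg_left (mul_le_mul_of_nonneg_left (mul_le_mul_of_nonneg_left
      (sum_zpow_le hs q) (by positivity)) (by positivity)) (by norm_num)).trans (le_of_eq ?_)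
    rw [zpow_sub₀ hρne, zpow_sub₀ hρne, zpow_mul, zpow_neg, zpow_neg]
    have e : (ρ ^ 2) ^ (q : ℤ) = (ρ ^ (2 : ℤ)) ^ (q : ℤ) := by norm_cast
    rw [e]
    have a1 : ρ ^ P.1 ≠ 0 := by positivity
    have a2 : ρ ^ P.2 ≠ 0 := by positivity
    field_simp
  -- The pairs of the flux lie in three diagonals |p' - p''| < 2 starting at p' = q - 1. A pair of ι
  -- with p'' < q contributes zero, so the parametrization may include it.
  set ι : ℕ × Fin 3 → ℤ × ℤ := fun m => ((q : ℤ) - 1 + m.1, (q : ℤ) - 1 + m.1 + (m.2 : ℤ) - 1)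
    with hι
  have hinj : Function.Injective ι := by
    rintro ⟨a, b⟩ ⟨a', b'⟩ h
    simp only [hι, Prod.mk.injEq] at h
    have h1 : a = a' := by omega
    have h2 : b = b' := Fin.ext (by omega)
    rw [h1, h2]
  have hnn (m : ℕ × Fin 3) : ∫⁻ z in E, Φ (ι m) z ∂avgMeasure L T ≤
      ENNReal.ofReal (δ ^ 2 * c * ((ρ ^ 2)⁻¹) ^ m.1) := by
    by_cases h : (q : ℤ) - 1 ≤ (ι m).1 ∧ (q : ℤ) ≤ (ι m).2 ∧ |(ι m).1 - (ι m).2| < 2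
    · refine (hint _ h).trans (ENNReal.ofReal_le_ofReal ?_)
      -- With p' = q - 1 + m and p'' = p' + b - 1 the exponent is 3 - 2m - b, at most 3 - 2m.
      have h3 : ρ ^ (2 * (q : ℤ) - (ι m).1 - (ι m).2) ≤ ρ ^ 3 * ((ρ ^ 2)⁻¹) ^ m.1 := by
        rw [inv_pow, ← pow_mul, ← zpow_natCast, ← zpow_natCast, ← zpow_neg, ← zpow_add₀ hρne]
        refine zpow_le_zpow_right₀ hρ1.le ?_
        simp only [hι]; push_cast; omega
      calc _ ≤ δ ^ 2 * (9 * C * A / (ρ ^ 2 - 1)) * (ρ ^ 3 * ((ρ ^ 2)⁻¹) ^ m.1) := by gcongr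
        _ = _ := by rw [hc]; ring
    · simp only [hΦ, if_neg h]; simp
  calc ∫⁻ z in E, ‖fluxDensity χ (fun t => u t) q z‖ₑ ∂avgMeasure L T
      ≤ ∫⁻ z in E, ∑' P, Φ P z ∂avgMeasure L T := lintegral_mono hpt
    _ = ∑' P, ∫⁻ z in E, Φ P z ∂avgMeasure L T :=
        lintegral_tsum fun P => (hΦm P).aemeasurable
    _ = ∑' m, ∫⁻ z in E, Φ (ι m) z ∂avgMeasure L T := by
        refine (hinj.tsum_eq ?_).symm
        intro P hP
        by_cases h : (q : ℤ) - 1 ≤ P.1 ∧ (q : ℤ) ≤ P.2 ∧ |P.1 - P.2| < 2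
        · have h3 := abs_lt.1 h.2.2
          refine ⟨((P.1 - (q - 1)).toNat, ⟨(P.2 - P.1 + 1).toNat, by omega⟩), ?_⟩
          simp only [hι]
          ext <;> simp <;> omega
        · exact absurd (by simp only [hΦ, if_neg h]; simp) hP
    _ ≤ ∑' m : ℕ × Fin 3, ENNReal.ofReal (δ ^ 2 * c * ((ρ ^ 2)⁻¹) ^ m.1) :=
        ENNReal.tsum_le_tsum hnn
    _ = ∑' n : ℕ, 3 * ENNReal.ofReal (δ ^ 2 * c * ((ρ ^ 2)⁻¹) ^ n) := by
        rw [ENNReal.tsum_prod (f := fun n (_ : Fin 3) =>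
          ENNReal.ofReal (δ ^ 2 * c * ((ρ ^ 2)⁻¹) ^ n))]
        refine tsum_congr fun n => ?_
        simp
    _ = _ := by
        rw [ENNReal.tsum_mul_left, ← ENNReal.ofReal_tsum_of_nonneg (fun n => by positivity)
          ((summable_geometric_of_lt_one hr0 hr1).mul_left _), tsum_mul_left,
          tsum_geometric_of_lt_one hr0 hr1, ← ENNReal.ofReal_ofNat 3,
          ← ENNReal.ofReal_mul (by norm_num)]
        congr 1; ring

lemma avgPow_block_lt_top {L T : ℝ} [Fact (0 < L)] (hT : 0 < T) (χ : Cutoff)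
    {u : Icc (0 : ℝ) T → L2Field L} (hu : WeaklyContinuous u) (q : ℤ) (r : ℕ) :
    avgPow r (blockST χ (fun t => u t) q : SpaceTime L T → E3) < ⊤ := by
  have := isProbabilityMeasure_avgMeasure (L := L) hT
  obtain ⟨C, hC⟩ := isCompact_univ.exists_bound_of_continuousOn
    (hu.continuous_blockST χ q).continuousOn
  rw [avgPow_eq]
  refine (lintegral_mono (g := fun _ => ENNReal.ofReal C ^ r) fun z => ?_).trans_lt ?_
  · have : ‖blockST χ (fun t => u t) q z‖ₑ ≤ ENNReal.ofReal C := by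
      rw [← ofReal_norm]; exact ENNReal.ofReal_le_ofReal (hC z trivial)
    exact pow_le_pow_left' this r
  · simp

lemma lam_pos {L : ℝ} (hL : 0 < L) (q : ℤ) : 0 < lam L q := by unfold lam; positivity

/-- The limsup controls all blocks from some index on; the finitely many remaining ones are
continuous on a compact space, hence have finite averages. -/
lemma exists_avgPow_le_of_onsager_lt_top {L T : ℝ} [hL : Fact (0 < L)] (hT : 0 < T) (χ : Cutoff)
    {u : Icc (0 : ℝ) T → L2Field L} (hu : WeaklyContinuous u)
    (hε : onsager χ (fun t => u t) < ⊤) : ∃ A : ℝ, 0 ≤ A ∧ ∀ p : ℤ, -1 ≤ p →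
      avgPow 3 (blockST χ (fun t => u t) p : SpaceTime L T → E3) ≤
        ENNReal.ofReal (A ^ 3 * 2 ^ (-p)) := by
  have hL' := hL.out
  obtain ⟨B, hB, -⟩ := ENNReal.lt_iff_exists_nnreal_btwn.1 hε
  obtain ⟨R, hR⟩ := eventually_atTop.1 (eventually_lt_of_limsup_lt hB)
  set a : ℤ → ℝ≥0∞ := fun p => avgPow 3 (blockST χ (fun t => u t) p : SpaceTime L T → E3)
  have ha (p : ℤ) : a p < ⊤ := avgPow_block_lt_top hT χ hu p 3
  set m : ℝ := L * B + ∑ p ∈ Finset.Ico (-1 : ℤ) R, 2 ^ p * (a p).toReal with hm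
  have hs (p : ℤ) : 0 ≤ 2 ^ p * (a p).toReal := by positivity
  have hm0 : 0 ≤ m := add_nonneg (by positivity) (Finset.sum_nonneg fun p _ => hs p)
  have key (p : ℤ) (hp : -1 ≤ p) : 2 ^ p * (a p).toReal ≤ m := by
    by_cases h : p < R
    · have := Finset.single_le_sum (f := fun p : ℤ => 2 ^ p * (a p).toReal) (fun p _ => hs p)
        (Finset.mem_Ico.2 ⟨hp, h⟩)
      have h2 : 0 ≤ L * (B : ℝ) := by positivity
      linarith
    · lift p to ℕ using by omega
      have h1 := (hR p (by omega)).le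
      have h2 := ENNReal.toReal_mono ENNReal.coe_ne_top h1
      rw [ENNReal.toReal_mul, ENNReal.toReal_ofReal (lam_pos hL' _).le, lam,
        ENNReal.coe_toReal, div_mul_eq_mul_div, div_le_iff₀ hL'] at h2
      have h3 := Finset.sum_nonneg (s := Finset.Ico (-1 : ℤ) R) fun p _ => hs p
      linarith
  -- For m ≥ 0, 1 + m satisfies (1 + m)³ ≥ m, so no cube root has to be taken.
  refine ⟨1 + m, by linarith, fun p hp => ?_⟩
  change a p ≤ _
  rw [← ENNReal.ofReal_toReal (ha p).ne]
  refine ENNReal.ofReal_le_ofReal ?_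
  have h1 : 1 + m ≤ (1 + m) ^ 3 := le_self_pow₀ (by linarith) (by norm_num)
  have h2 := key p hp
  rw [zpow_neg, ← div_eq_mul_inv, le_div_iff₀ (by positivity)]
  linarith

/-- The flux tends to zero on `E` if the Onsager quantity of the blocks does. -/
lemma tendsto_flux_of_tendsto_blocks (χ : Cutoff) {L T : ℝ} [hL : Fact (0 < L)] (hT : 0 < T)
    {u : Icc (0 : ℝ) T → L2Field L} (hu : WeaklyContinuous u)
    (hε : onsager χ (fun t => u t) < ⊤) {E : Set (SpaceTime L T)}
    (hE : Tendsto (fun r : ℕ => ENNReal.ofReal (lam L r) *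
      ∫⁻ z in E, ‖blockST χ (fun t => u t) r z‖ₑ ^ 3 ∂avgMeasure L T) atTop (𝓝 0)) :
    Tendsto (fun q : ℕ => ∫⁻ z in E, ‖fluxDensity χ (fun t => u t) q z‖ₑ ∂avgMeasure L T)
      atTop (𝓝 0) := by
  have hL' := hL.out
  obtain ⟨A, hA0, hA⟩ := exists_avgPow_le_of_onsager_lt_top hT χ hu hε
  obtain ⟨K, hK⟩ := exists_flux_bound χ hT hu hA0 hA
  rw [ENNReal.tendsto_nhds_zero]
  intro ε hε0
  have hlim : Tendsto (fun δ : ℝ => ENNReal.ofReal (K * δ ^ 2)) (𝓝[>] 0) (𝓝 0) := by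
    have : Tendsto (fun δ : ℝ => ENNReal.ofReal (K * δ ^ 2)) (𝓝 0)
        (𝓝 (ENNReal.ofReal (K * 0 ^ 2))) :=
      (ENNReal.continuous_ofReal.comp (by fun_prop)).tendsto 0
    simp only [ne_eq, OfNat.ofNat_ne_zero, not_false_eq_true, zero_pow, mul_zero,
      ENNReal.ofReal_zero] at this
    exact this.mono_left nhdsWithin_le_nhds
  obtain ⟨δ, hδε, hδ0⟩ := ((ENNReal.tendsto_nhds_zero.1 hlim ε hε0).and
    self_mem_nhdsWithin).exists
  have hδ0 : 0 < δ := hδ0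
  obtain ⟨R, hR⟩ := eventually_atTop.1 ((ENNReal.tendsto_nhds_zero.1 hE)
    (ENNReal.ofReal (δ ^ 3 / L)) (by simp; positivity))
  -- The shift by one is needed because the flux of index q involves blocks down to q - 1.
  filter_upwards [eventually_ge_atTop (R + 1)] with q hq
  refine (hK E δ q hδ0.le fun r hr => ?_).trans hδε
  lift r to ℕ using by omega
  have h := hR r (by omega)
  have hl := lam_pos hL' r
  rw [mul_comm, ← ENNReal.le_div_iff_mul_le (Or.inl (by simpa using hl))
    (Or.inl ENNReal.ofReal_ne_top), ← ENNReal.ofReal_div_of_pos hl] at h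
  refine h.trans (le_of_eq ?_)
  congr 1
  rw [lam, zpow_neg]
  field_simp

/-! ### Decay of the Littlewood-Paley kernels -/

/-- The backward difference of `F` with step `a`. -/
def shiftDiff (a : E3) (F : E3 → ℝ) (ξ : E3) : ℝ := F (ξ - a) - F ξ

lemma contDiff_shiftDiff_iterate (a : E3) (n : ℕ) {F : E3 → ℝ} (hF : ContDiff ℝ ∞ F) :
    ContDiff ℝ ∞ ((shiftDiff a)^[n] F) := by
  induction n with
  | zero => exact hF
  | succ n ih =>
    rw [Function.iterate_succ_apply']
    exact (ih.comp (contDiff_id.sub contDiff_const)).sub ih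

lemma fderiv_shiftDiff_iterate (a e : E3) (n : ℕ) {F : E3 → ℝ} (hF : ContDiff ℝ ∞ F) (ξ : E3) :
    fderiv ℝ ((shiftDiff a)^[n] F) ξ e = (shiftDiff a)^[n] (fun ξ => fderiv ℝ F ξ e) ξ := by
  induction n generalizing ξ with
  | zero => rfl
  | succ n ih =>
    rw [Function.iterate_succ_apply', Function.iterate_succ_apply']
    have hd := (contDiff_shiftDiff_iterate a n hF).differentiable (by simp)
    have h : fderiv ℝ (shiftDiff a ((shiftDiff a)^[n] F)) ξ =
        fderiv ℝ ((shiftDiff a)^[n] F) (ξ - a) - fderiv ℝ ((shiftDiff a)^[n] F) ξ := by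
      have h1 := ((hd (ξ - a)).hasFDerivAt.comp ξ ((hasFDerivAt_id ξ).sub_const a)).sub
        (hd ξ).hasFDerivAt
      rw [ContinuousLinearMap.comp_id] at h1
      exact h1.fderiv
    rw [h, sub_apply, ih, ih]
    rfl

/-- By the mean value inequality the outermost difference costs h times a derivative. That
derivative commutes with the remaining differences, so induction applies to ∂_e F, again smooth with
compact support. -/
lemma exists_shiftDiff_iterate_le (e : E3) (n : ℕ) : ∀ {F : E3 → ℝ}, ContDiff ℝ ∞ F →
    HasCompactSupport F → ∃ C : ℝ, ∀ h : ℝ, 0 ≤ h → ∀ ξ,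
      |(shiftDiff (h • e))^[n] F ξ| ≤ C * h ^ n := by
  induction n with
  | zero =>
    intro F hF hc
    obtain ⟨C, hC⟩ := hF.continuous.bounded_above_of_compact_support hc
    exact ⟨C, fun h _ ξ => by simpa using hC ξ⟩
  | succ n ih =>
    intro F hF hc
    have h1 : ContDiff ℝ ∞ (fun ξ => fderiv ℝ F ξ e) :=
      (hF.fderiv_right (m := ∞) (by simp)).clm_apply contDiff_const
    have h2 : HasCompactSupport (fun ξ => fderiv ℝ F ξ e) := hc.fderiv_apply (𝕜 := ℝ) e
    obtain ⟨C, hC⟩ := ih h1 h2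
    refine ⟨C, fun h hh ξ => ?_⟩
    set G := (shiftDiff (h • e))^[n] F with hG
    have hGd : Differentiable ℝ G :=
      (contDiff_shiftDiff_iterate (h • e) n hF).differentiable (by simp)
    rw [Function.iterate_succ_apply', ← hG, shiftDiff]
    have hder (s : ℝ) : HasDerivAt (fun s : ℝ => G (ξ - s • h • e))
        (fderiv ℝ G (ξ - s • h • e) (-(h • e))) s := by
      refine (hGd _).hasFDerivAt.comp_hasDerivAt s ?_
      simpa using ((hasDerivAt_id s).smul_const (h • e)).const_sub ξ
    have := norm_image_sub_le_of_norm_deriv_le_segment_01'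
      (f := fun s : ℝ => G (ξ - s • h • e)) (C := C * h ^ (n + 1))
      (fun s _ => (hder s).hasDerivWithinAt) (fun s _ => by
        rw [map_neg, map_smul, norm_neg, hG, fderiv_shiftDiff_iterate _ _ _ hF, norm_smul,
          Real.norm_of_nonneg hh, pow_succ, ← mul_assoc, mul_comm]
        exact mul_le_mul_of_nonneg_right (hC h hh _) hh)
    simpa using this

/-- The trigonometric series with coefficients `m`. -/
def trigSum (L : ℝ) (m : (Fin 3 → ℤ) → ℂ) (x : Torus L) : ℂ := ∑' k, m k * character k x

/-- The backward difference of a sequence in the direction of the `i`-th coordinate. -/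
def seqDiff (i : Fin 3) (m : (Fin 3 → ℤ) → ℂ) (k : Fin 3 → ℤ) : ℂ := m (k - Pi.single i 1) - m k

lemma seqDiff_iterate_support (i : Fin 3) (n : ℕ) {N : ℕ} {m : (Fin 3 → ℤ) → ℂ}
    (hm : ∀ k, k ∉ freqBox N → m k = 0) :
    ∀ k, k ∉ freqBox (N + n) → (seqDiff i)^[n] m k = 0 := by
  induction n with
  | zero => exact hm
  | succ n ih =>
    intro k hk
    rw [Function.iterate_succ_apply', seqDiff, ih, ih, sub_zero]
    · contrapose! hk
      rw [mem_freqBox] at hk ⊢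
      intro j
      have := hk j
      push_cast at this ⊢
      linarith
    · contrapose! hk
      rw [mem_freqBox] at hk ⊢
      intro j
      have := hk j
      rw [Pi.sub_apply, abs_le] at this
      have h1 : 0 ≤ (Pi.single i 1 : Fin 3 → ℤ) j ∧ (Pi.single i 1 : Fin 3 → ℤ) j ≤ 1 := by
        by_cases h : j = i
        · subst h; simp
        · simp [h]
      push_cast at this ⊢
      rw [abs_le]
      constructor <;> linarith [h1.1, h1.2]

lemma trigSum_eq_sum {L : ℝ} {N : ℕ} {m : (Fin 3 → ℤ) → ℂ}
    (hm : ∀ k, k ∉ freqBox N → m k = 0) (x : Torus L) :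
    trigSum L m x = ∑ k ∈ freqBox N, m k * character k x :=
  tsum_eq_sum fun k hk => by rw [hm k hk, zero_mul]

lemma summable_comp_sub {f : (Fin 3 → ℤ) → ℂ} (hf : Summable f) (a : Fin 3 → ℤ) :
    Summable fun k => f (k - a) :=
  (Equiv.subRight a).summable_iff.2 hf

lemma tsum_comp_sub (f : (Fin 3 → ℤ) → ℂ) (a : Fin 3 → ℤ) : ∑' k, f (k - a) = ∑' k, f k :=
  (Equiv.subRight a).tsum_eq f

/-- Summation by parts: shifting the coefficients by e_i multiplies the series by the character of
e_i. -/
lemma trigSum_seqDiff {L : ℝ} (i : Fin 3) {N : ℕ} {m : (Fin 3 → ℤ) → ℂ}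
    (hm : ∀ k, k ∉ freqBox N → m k = 0) (x : Torus L) :
    trigSum L (seqDiff i m) x = (fourier 1 (x i) - 1) * trigSum L m x := by
  have hs : Summable fun k => m k * character k x :=
    summable_of_ne_finset_zero (s := freqBox N) fun k hk => by rw [hm k hk, zero_mul]
  have e (k : Fin 3 → ℤ) : seqDiff i m k * character k x =
      fourier 1 (x i) * (m (k - Pi.single i 1) * character (k - Pi.single i 1) x) -
        m k * character k x := by
    have : character k x = character (k - Pi.single i 1) x * fourier 1 (x i) := by
      rw [← character_single, ← character_add, sub_add_cancel]
    rw [seqDiff, sub_mul]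
    nth_rw 1 [this]
    ring
  rw [trigSum, tsum_congr e,
    ((summable_comp_sub hs (Pi.single i 1)).mul_left _).tsum_sub hs, tsum_mul_left,
    tsum_comp_sub (fun k => m k * character k x), trigSum]
  ring

lemma trigSum_seqDiff_iterate {L : ℝ} (i : Fin 3) (n : ℕ) {N : ℕ} {m : (Fin 3 → ℤ) → ℂ}
    (hm : ∀ k, k ∉ freqBox N → m k = 0) (x : Torus L) :
    trigSum L ((seqDiff i)^[n] m) x = (fourier 1 (x i) - 1) ^ n * trigSum L m x := by
  induction n with
  | zero => simp
  | succ n ih =>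
    rw [Function.iterate_succ_apply', trigSum_seqDiff i (seqDiff_iterate_support i n hm), ih]
    ring

/-- The function `φ` of the dyadic decomposition. -/
def Cutoff.annulus (χ : Cutoff) (ξ : E3) : ℝ := χ.toFun ((1 / 2 : ℝ) • ξ) - χ.toFun ξ

lemma Cutoff.contDiff_annulus (χ : Cutoff) : ContDiff ℝ ∞ χ.annulus :=
  (χ.smooth.comp (contDiff_const_smul _)).sub χ.smooth

lemma Cutoff.hasCompactSupport_annulus (χ : Cutoff) : HasCompactSupport χ.annulus := by
  refine HasCompactSupport.intro (isCompact_closedBall (0 : E3) 2) fun ξ hξ => ?_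
  rw [mem_closedBall_zero_iff, not_le] at hξ
  rw [Cutoff.annulus, χ.eq_zero, χ.eq_zero, sub_zero]
  · linarith
  · rw [norm_smul, Real.norm_of_nonneg (by norm_num)]; linarith

lemma multiplier_natCast (χ : Cutoff) {L : ℝ} (hL : 0 < L) (q : ℕ) (k : Fin 3 → ℤ) :
    multiplier χ L q (freq L k) = χ.annulus (((2 : ℝ) ^ q)⁻¹ • kvec k) := by
  have e : (L / 2 ^ (q : ℤ)) • freq L k = ((2 : ℝ) ^ q)⁻¹ • kvec k := by
    rw [← smul_freq hL, smul_smul, zpow_natCast]; congr 1; ring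
  rw [multiplier, if_neg (by omega), if_neg (by omega), e, Cutoff.annulus]

lemma kvec_sub_single (k : Fin 3 → ℤ) (i : Fin 3) :
    kvec (k - Pi.single i 1) = kvec k - EuclideanSpace.single i 1 := by
  ext j
  by_cases h : j = i
  · subst h; simp [kvec]
  · simp [kvec, h]

/-- The convolution kernel of the block of index `q`, up to normalization. -/
def blockKernel (χ : Cutoff) (L : ℝ) (q : ℕ) (x : Torus L) : ℂ :=
  trigSum L (fun k => (multiplier χ L q (freq L k) : ℂ)) x

/-- The coefficients sample a fixed smooth function at spacing 2^(-q), so four differences gain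
2^(-4q), while O(2^(3q)) frequencies are summed. Four differences leave a net gain of 2^(-q),
whereas three would leave none. -/
lemma exists_blockKernel_decay (χ : Cutoff) {L : ℝ} (hL : 0 < L) :
    ∃ C : ℝ, 0 ≤ C ∧ ∀ (q : ℕ) (i : Fin 3) (x : Torus L),
      ‖(fourier 1 (x i) : ℂ) - 1‖ ^ 4 * ‖blockKernel χ L q x‖ ≤ C / 2 ^ q := by
  choose C hC using fun i : Fin 3 => exists_shiftDiff_iterate_le (EuclideanSpace.single i 1) 4
    χ.contDiff_annulus χ.hasCompactSupport_annulus
  have hC0 (i : Fin 3) : 0 ≤ C i := by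
    have := (abs_nonneg _).trans (hC i 1 zero_le_one 0)
    simpa using this
  refine ⟨13 ^ 3 * ∑ i, C i, mul_nonneg (by norm_num) (Finset.sum_nonneg fun i _ => hC0 i),
    fun q i x => ?_⟩
  have h2 : (0 : ℝ) < 2 ^ q := by positivity
  set m : (Fin 3 → ℤ) → ℂ := fun k => (multiplier χ L q (freq L k) : ℂ) with hm
  have hsupp : ∀ k, k ∉ freqBox (freqBound q) → m k = 0 := fun k hk => by
    simp only [hm, multiplier_eq_zero_of_notMem χ hL hk, Complex.ofReal_zero]
  have hdiff (n : ℕ) (k : Fin 3 → ℤ) : (seqDiff i)^[n] m k =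
      (((shiftDiff (((2 : ℝ) ^ q)⁻¹ • EuclideanSpace.single i 1))^[n] χ.annulus
        (((2 : ℝ) ^ q)⁻¹ • kvec k) : ℝ) : ℂ) := by
    induction n generalizing k with
    | zero => simp only [hm, multiplier_natCast χ hL, Function.iterate_zero, id]
    | succ n ih =>
      rw [Function.iterate_succ_apply', Function.iterate_succ_apply', seqDiff, shiftDiff, ih, ih,
        kvec_sub_single, smul_sub, Complex.ofReal_sub]
  rw [blockKernel, ← norm_pow, ← norm_mul, ← trigSum_seqDiff_iterate i 4 hsupp,
    trigSum_eq_sum (seqDiff_iterate_support i 4 hsupp)]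
  refine (norm_sum_le_of_le (freqBox (freqBound q + 4))
    (f := fun k => (seqDiff i)^[4] m k * character k x)
    (n := fun _ => C i * ((2 : ℝ) ^ q)⁻¹ ^ 4) fun k _ => ?_).trans ?_
  · rw [norm_mul, norm_character, mul_one, hdiff, Complex.norm_real]
    exact hC i _ (by positivity) _
  · rw [Finset.sum_const, card_freqBox, nsmul_eq_mul]
    -- Four differences enlarge the frequency box by 4, and 2(2^(q+1) + 4) + 1 = 4·2^q + 9 ≤ 13·2^q.
    have hb : ((2 * (freqBound q + 4) + 1 : ℕ) : ℝ) ≤ 13 * 2 ^ q := by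
      rw [freqBound, show ((q : ℤ) + 1).toNat = q + 1 by omega]
      push_cast
      have : (1 : ℝ) ≤ 2 ^ q := one_le_pow₀ one_le_two
      rw [pow_succ]; linarith
    have hCi : C i ≤ ∑ i, C i := Finset.single_le_sum (fun i _ => hC0 i) (Finset.mem_univ i)
    push_cast only [Nat.cast_pow]
    calc ((2 * (freqBound q + 4) + 1 : ℕ) : ℝ) ^ 3 * (C i * ((2 : ℝ) ^ q)⁻¹ ^ 4)
        ≤ (13 * 2 ^ q) ^ 3 * ((∑ i, C i) * ((2 : ℝ) ^ q)⁻¹ ^ 4) := by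
          have := hC0 i
          gcongr
      _ = _ := by field_simp

lemma block_eq_integral (χ : Cutoff) {L : ℝ} [hL : Fact (0 < L)] (q : ℕ) {v : Torus L → E3}
    (hv : Integrable v) (x : Torus L) (j : Fin 3) :
    block χ q v x j =
      (1 / (L : ℂ) ^ 3 * ∫ y, ((v y j : ℝ) : ℂ) * blockKernel χ L q (x - y)).re := by
  have hvj : Integrable (fun y => v y j) := (EuclideanSpace.proj (𝕜 := ℝ) j).integrable_comp hv
  rw [block_apply]
  congr 1
  have h (y : Torus L) : ((v y j : ℝ) : ℂ) * blockKernel χ L q (x - y) =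
      ∑ k ∈ freqBox (freqBound q), (multiplier χ L q (freq L k) : ℂ) * character k x *
        (((v y j : ℝ) : ℂ) * character (-k) y) := by
    rw [blockKernel, trigSum_eq_sum (N := freqBound q) fun k hk => by
      simp only [multiplier_eq_zero_of_notMem χ hL.out hk, Complex.ofReal_zero], Finset.mul_sum]
    refine Finset.sum_congr rfl fun k _ => ?_
    rw [sub_eq_add_neg, character_apply_add, ← character_neg]; ring
  simp only [h]
  rw [integral_finsetSum _ fun k _ => (integrable_coord_mul_character hvj (-k)).const_mul _,
    Finset.mul_sum]
  refine Finset.sum_congr rfl fun k _ => ?_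
  rw [integral_const_mul, fourierCoef]
  ring

lemma enorm_le_of_forall_coord {w : E3} {B : ℝ≥0∞} (h : ∀ j, ‖w j‖ₑ ≤ B) : ‖w‖ₑ ≤ 3 * B := by
  have e : w = ∑ j, EuclideanSpace.single j (w j) := by
    ext i; simp [Finset.sum_apply, Pi.single_apply]
  calc ‖w‖ₑ = ‖∑ j, EuclideanSpace.single j (w j)‖ₑ := by rw [← e]
    _ ≤ ∑ j : Fin 3, ‖EuclideanSpace.single j (w j)‖ₑ := enorm_sum_le _ _
    _ ≤ ∑ j : Fin 3, B := Finset.sum_le_sum fun j _ => by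
        rw [← ofReal_norm, PiLp.norm_single, ofReal_norm]; exact h j
    _ = 3 * B := by simp

/-- Off-diagonal decay of the blocks. -/
lemma exists_block_offDiagonal (χ : Cutoff) {L : ℝ} [hL : Fact (0 < L)] :
    ∃ C : ℝ, 0 ≤ C ∧ ∀ (q : ℕ) (v : Torus L → E3), Integrable v → ∀ (x : Torus L) (c : ℝ), 0 < c →
      (∀ y, v y ≠ 0 → ∃ i, c ≤ ‖(fourier 1 ((x - y) i) : ℂ) - 1‖) →
      ‖block χ q v x‖ₑ ≤ ENNReal.ofReal (C / c ^ 4 / 2 ^ q) * ∫⁻ y, ‖v y‖ₑ := by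
  obtain ⟨C, hC0, hC⟩ := exists_blockKernel_decay χ hL.out
  have hL' := hL.out
  refine ⟨3 * (1 / L ^ 3 * C), by positivity, fun q v hv x c hc h => ?_⟩
  have h1 (j : Fin 3) : ‖block χ q v x j‖ₑ ≤
      ENNReal.ofReal (1 / L ^ 3 * C / c ^ 4 / 2 ^ q) * ∫⁻ y, ‖v y‖ₑ := by
    rw [block_eq_integral χ q hv x j]
    have hre (z : ℂ) : ‖z.re‖ₑ ≤ ‖z‖ₑ := by
      rw [← ofReal_norm, ← ofReal_norm]
      exact ENNReal.ofReal_le_ofReal (Complex.abs_re_le_norm z)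
    refine (hre _).trans ?_
    rw [enorm_mul]
    have e1 : ‖(1 / (L : ℂ) ^ 3)‖ₑ = ENNReal.ofReal (1 / L ^ 3) := by
      rw [← ofReal_norm]
      simp [abs_of_pos hL']
    rw [e1, show 1 / L ^ 3 * C / c ^ 4 / 2 ^ q = 1 / L ^ 3 * (C / c ^ 4 / 2 ^ q) by ring,
      ENNReal.ofReal_mul (by positivity), mul_assoc,
      ← lintegral_const_mul' _ _ ENNReal.ofReal_ne_top]
    refine mul_le_mul' le_rfl ((enorm_integral_le_lintegral_enorm _).trans
      (lintegral_mono fun y => ?_))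
    by_cases hy : v y = 0
    · simp [hy]
    · obtain ⟨i, hi⟩ := h y hy
      rw [enorm_mul, mul_comm]
      refine mul_le_mul' ?_ ?_
      · rw [← ofReal_norm]
        refine ENNReal.ofReal_le_ofReal ?_
        have h2 := hC q i (x - y)
        have h3 : c ^ 4 * ‖blockKernel χ L q (x - y)‖ ≤ C / 2 ^ q :=
          (mul_le_mul_of_nonneg_right (pow_le_pow_left₀ hc.le hi 4) (norm_nonneg _)).trans h2
        rw [div_right_comm, le_div_iff₀ (by positivity), mul_comm]
        exact h3
      · rw [← ofReal_norm, ← ofReal_norm, Complex.norm_real]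
        exact ENNReal.ofReal_le_ofReal (PiLp.norm_apply_le _ j)
  refine (enorm_le_of_forall_coord h1).trans (le_of_eq ?_)
  rw [← mul_assoc]
  congr 1
  rw [← ENNReal.ofReal_ofNat 3, ← ENNReal.ofReal_mul (by norm_num)]
  congr 1; ring

/-! ### Decay of the blocks on regular sets -/

/-- Weakly continuous functions on a compact interval are weakly bounded, hence bounded in L² by
uniform boundedness, and so in L¹ since the torus has finite measure. -/
lemma WeaklyContinuous.exists_lintegral_le {L T : ℝ} [Fact (0 < L)]
    {u : Icc (0 : ℝ) T → L2Field L} (hu : WeaklyContinuous u) :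
    ∃ B : ℝ≥0∞, B ≠ ⊤ ∧ ∀ t, ∫⁻ y, ‖u t y‖ₑ ≤ B := by
  obtain ⟨C, hC⟩ := banach_steinhaus (g := fun t => innerSL ℝ (u t)) fun w => by
    obtain ⟨C, hC⟩ := isCompact_univ.exists_bound_of_continuousOn (hu w).continuousOn
    exact ⟨C, fun t => hC t trivial⟩
  refine ⟨ENNReal.ofReal C * volume (univ : Set (Torus L)) ^ (1 / (1 : ℝ≥0∞).toReal -
    1 / (2 : ℝ≥0∞).toReal), ENNReal.mul_ne_top ENNReal.ofReal_ne_top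
      (ENNReal.rpow_ne_top_of_nonneg (by norm_num) (measure_ne_top _ _)), fun t => ?_⟩
  rw [← eLpNorm_one_eq_lintegral_enorm]
  refine (eLpNorm_le_eLpNorm_mul_rpow_measure_univ one_le_two
    (Lp.aestronglyMeasurable (u t))).trans (mul_le_mul' ?_ le_rfl)
  have h := hC t
  rw [innerSL_apply_norm, Lp.norm_def] at h
  exact (ENNReal.le_ofReal_iff_toReal_le (Lp.eLpNorm_ne_top _)
    (ENNReal.toReal_nonneg.trans h)).2 h

lemma block_add (χ : Cutoff) {L : ℝ} [hL : Fact (0 < L)] (q : ℤ) {v w : Torus L → E3}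
    (hv : Integrable v) (hw : Integrable w) (x : Torus L) :
    block χ q (fun y => v y + w y) x = block χ q v x + block χ q w x := by
  ext j
  have hvj : Integrable (fun y => v y j) := (EuclideanSpace.proj (𝕜 := ℝ) j).integrable_comp hv
  have hwj : Integrable (fun y => w y j) := (EuclideanSpace.proj (𝕜 := ℝ) j).integrable_comp hw
  rw [PiLp.add_apply, block_apply, block_apply, block_apply, ← Complex.add_re,
    ← Finset.sum_add_distrib]
  congr 1
  refine Finset.sum_congr rfl fun k _ => ?_
  have : fourierCoef (fun y => v y + w y) k j = fourierCoef v k j + fourierCoef w k j := by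
    unfold fourierCoef
    rw [← mul_add, ← integral_add (integrable_coord_mul_character hvj (-k))
      (integrable_coord_mul_character hwj (-k))]
    simp only [PiLp.add_apply, Complex.ofReal_add, add_mul]
  rw [this]; ring

/-! ### Localization near a regular point -/

/-- A smooth function on space-time that vanishes exactly at `(t₀, x₀)`. -/
def bumpDist {L : ℝ} (t₀ : ℝ) (x₀ : Torus L) (t : ℝ) (x : Torus L) : ℝ :=
  (t - t₀) ^ 2 + ∑ i, (1 - (fourier 1 (x i - x₀ i) : ℂ).re)

lemma continuous_bumpDist {L : ℝ} (t₀ : ℝ) (x₀ : Torus L) :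
    Continuous fun z : ℝ × Torus L => bumpDist t₀ x₀ z.1 z.2 := by
  unfold bumpDist
  have (i : Fin 3) : Continuous fun z : ℝ × Torus L => (fourier 1 (z.2 i - x₀ i) : ℂ).re :=
    Complex.continuous_re.comp ((fourier 1).continuous.comp (by fun_prop))
  fun_prop

lemma fourier_one_re_le {L : ℝ} (x : AddCircle L) : (fourier 1 x : ℂ).re ≤ 1 :=
  (Complex.re_le_norm _).trans (norm_fourier_apply 1 x).le

lemma bumpDist_self {L : ℝ} (t₀ : ℝ) (x₀ : Torus L) : bumpDist t₀ x₀ t₀ x₀ = 0 := by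
  simp [bumpDist]

lemma bumpDist_pos {L : ℝ} (hL : 0 < L) {t₀ t : ℝ} {x₀ x : Torus L} (h : (t, x) ≠ (t₀, x₀)) :
    0 < bumpDist t₀ x₀ t x := by
  have h1 (i : Fin 3) : 0 ≤ 1 - (fourier 1 (x i - x₀ i) : ℂ).re := by
    linarith [fourier_one_re_le (x i - x₀ i)]
  have h2 : 0 ≤ ∑ i, (1 - (fourier 1 (x i - x₀ i) : ℂ).re) := Finset.sum_nonneg fun i _ => h1 i
  have h3 := sq_nonneg (t - t₀)
  by_contra! hle
  unfold bumpDist at hle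
  apply h
  have ht : t = t₀ := by
    have : (t - t₀) ^ 2 = 0 := by linarith
    linarith [pow_eq_zero_iff (two_ne_zero) |>.1 this]
  have hx : x = x₀ := by
    ext i
    have h4 := (Finset.sum_eq_zero_iff_of_nonneg fun i _ => h1 i).1
      (by linarith : ∑ i, (1 - (fourier 1 (x i - x₀ i) : ℂ).re) = 0) i (Finset.mem_univ i)
    have hn := norm_fourier_apply 1 (x i - x₀ i)
    set w : ℂ := fourier 1 (x i - x₀ i) with hw
    have hre : w.re = 1 := by linarith
    have him : w.im = 0 := by
      have := Complex.sq_norm w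
      rw [hn, Complex.normSq_apply, hre] at this
      nlinarith
    have hw1 : w = 1 := Complex.ext hre him
    rw [hw, fourier_one] at hw1
    have h5 : (AddCircle.toCircle (x i - x₀ i)) = AddCircle.toCircle (0 : AddCircle L) := by
      rw [AddCircle.toCircle_zero]; exact Subtype.ext hw1
    exact sub_eq_zero.1 (AddCircle.injective_toCircle hL.ne' h5)
  rw [ht, hx]

lemma smoothInSpaceTime_bumpDist {L : ℝ} (t₀ : ℝ) (x₀ : Torus L) :
    SmoothInSpaceTime (bumpDist t₀ x₀) := by
  obtain ⟨y₀, rfl⟩ := toTorus_surjective L x₀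
  unfold SmoothInSpaceTime bumpDist
  have h (y : E3) (i : Fin 3) : (fourier 1 (toTorus L y i - toTorus L y₀ i) : ℂ).re =
      Real.cos (2 * Real.pi * (y i - y₀ i) / L) := by
    have : toTorus L y i - toTorus L y₀ i = ((y i - y₀ i : ℝ) : AddCircle L) := rfl
    rw [this, fourier_coe_apply, ← Complex.exp_ofReal_mul_I_re]
    congr 2
    push_cast; ring
  simp only [h]
  fun_prop

/-- The time terms agree, so only the three characters can account for the gap ε/2; one of them must
contribute at least ε/6. Separation is thus obtained in space at each fixed time. -/
lemma exists_separated {L : ℝ} {t₀ t ε : ℝ} {x₀ x y : Torus L}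
    (hx : bumpDist t₀ x₀ t x < ε / 2) (hy : ε < bumpDist t₀ x₀ t y) :
    ∃ i, ε / 6 ≤ ‖(fourier 1 ((x - y) i) : ℂ) - 1‖ := by
  by_contra! h
  have h1 (i : Fin 3) : (fourier 1 (x i - x₀ i) : ℂ).re - (fourier 1 (y i - x₀ i) : ℂ).re <
      ε / 6 := by
    refine lt_of_le_of_lt ?_ (h i)
    have e : (fourier 1 (x i - x₀ i) : ℂ) - fourier 1 (y i - x₀ i) =
        (fourier 1 ((x - y) i) - 1) * fourier 1 (y i - x₀ i) := by
      rw [sub_mul, one_mul, ← fourier_apply_add, Pi.sub_apply, sub_add_sub_cancel]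
    calc _ = ((fourier 1 (x i - x₀ i) : ℂ) - fourier 1 (y i - x₀ i)).re := by simp
      _ ≤ _ := Complex.re_le_norm _
      _ = _ := by rw [e, norm_mul, norm_fourier_apply, mul_one]
  have h2 := Finset.sum_lt_sum_of_nonempty (s := (Finset.univ : Finset (Fin 3)))
    Finset.univ_nonempty fun i _ => h1 i
  unfold bumpDist at hx hy
  simp only [Finset.sum_sub_distrib, Finset.sum_const, Finset.card_univ, Fintype.card_fin,
    nsmul_eq_mul] at h2 hx hy
  push_cast at h2 hx hy
  linarith

lemma tendsto_zero_of_onsager_eq_zero {χ : Cutoff} {L T : ℝ} [Fact (0 < L)]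
    {v : Icc (0 : ℝ) T → Torus L → E3} (h : onsager χ v = 0) :
    Tendsto (fun q : ℕ => ENNReal.ofReal (lam L q) * avgPow 3 (blockST χ v q)) atTop (𝓝 0) :=
  tendsto_of_le_liminf_of_limsup_le bot_le h.le

/-- Every point of a set of Onsager regularity has a neighbourhood on which the blocks decay. -/
lemma exists_nhds_tendsto_blocks (χ : Cutoff) {L T : ℝ} [hL : Fact (0 < L)] (hT : 0 < T)
    {u : Icc (0 : ℝ) T → L2Field L} (hu : WeaklyContinuous u) {U : Set (SpaceTime L T)}
    (hU : IsOpen U) (hreg : RegularOn χ (fun t => u t) U) {z₀ : SpaceTime L T} (hz₀ : z₀ ∈ U) :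
    ∃ V, IsOpen V ∧ z₀ ∈ V ∧ Tendsto (fun r : ℕ => ENNReal.ofReal (lam L r) *
      ∫⁻ z in V, ‖blockST χ (fun t => u t) r z‖ₑ ^ 3 ∂avgMeasure L T) atTop (𝓝 0) := by
  have hL' := hL.out
  have := isProbabilityMeasure_avgMeasure (L := L) hT
  set d : ℝ → Torus L → ℝ := bumpDist (z₀.1 : ℝ) z₀.2 with hd
  have hdc : Continuous fun z : ℝ × Torus L => d z.1 z.2 := continuous_bumpDist _ _
  have hdST : Continuous fun z : SpaceTime L T => d z.1 z.2 :=
    hdc.comp (by fun_prop : Continuous fun z : SpaceTime L T => ((z.1 : ℝ), z.2))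
  obtain ⟨a, ha0, ha⟩ := hU.isClosed_compl.isCompact.exists_forall_le' (a := 0)
    hdST.continuousOn (fun z hz => bumpDist_pos hL' fun h => hz (by
      have : z = z₀ := Prod.ext (Subtype.ext (Prod.mk.inj h).1) (Prod.mk.inj h).2
      rwa [this]))
  -- The distance function is at least a off U. The cutoff is 1 for d ≤ ε and 0 for d ≥ 2ε = a/2, so
  -- its support stays inside U; the neighbourhood d < ε/2 leaves room for `exists_separated`.
  set ε := a / 4 with hε
  have hε0 : 0 < ε := by positivity
  set φ : ℝ → Torus L → ℝ := fun t x => 1 - Real.smoothTransition (d t x / ε - 1) with hφ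
  have hφs : SmoothInSpaceTime φ := by
    have h1 : SmoothInSpaceTime d := smoothInSpaceTime_bumpDist _ _
    unfold SmoothInSpaceTime at h1 ⊢
    simp only [hφ]
    exact contDiff_const.sub (Real.smoothTransition.contDiff.comp ((h1.div_const _).sub
      contDiff_const))
  have hsupp : tsupport (fun z : SpaceTime L T => φ z.1 z.2) ⊆ U := by
    have h1 : tsupport (fun z : SpaceTime L T => φ z.1 z.2) ⊆ {z | d z.1 z.2 ≤ 2 * ε} := by
      refine closure_minimal (fun z hz => ?_) (isClosed_le hdST continuous_const)
      by_contra hlt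
      rw [mem_ofPred_eq, not_le] at hlt
      apply hz
      simp only [hφ]
      rw [Real.smoothTransition.one_of_one_le, sub_self]
      rw [le_sub_iff_add_le, le_div_iff₀ hε0]; linarith
    intro z hz
    by_contra hzU
    have h2 := ha z hzU
    have h3 : d z.1 z.2 ≤ 2 * ε := h1 hz
    linarith
  have htend := tendsto_zero_of_onsager_eq_zero (hreg φ hφs hsupp)
  obtain ⟨B, hB, hBu⟩ := hu.exists_lintegral_le
  obtain ⟨C, hC0, hC⟩ := exists_block_offDiagonal χ (L := L)
  refine ⟨{z | d z.1 z.2 < ε / 2}, isOpen_lt hdST continuous_const, ?_, ?_⟩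
  · rw [mem_ofPred_eq, hd, bumpDist_self]; positivity
  set κ : ℕ → ℝ≥0∞ := fun r => ENNReal.ofReal (C / (ε / 6) ^ 4 / 2 ^ r) * B with hκ
  set w : ℕ → SpaceTime L T → E3 :=
    fun r => blockST χ (fun (t : Icc (0 : ℝ) T) x => φ t x • u t x) r with hw
  have hφ01 (t : ℝ) (y : Torus L) : 0 ≤ φ t y ∧ φ t y ≤ 1 :=
    ⟨sub_nonneg.2 (Real.smoothTransition.le_one _),
      sub_le_self _ (Real.smoothTransition.nonneg _)⟩
  have hpt (r : ℕ) (z : SpaceTime L T) (hz : d z.1 z.2 < ε / 2) :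
      ‖blockST χ (fun t => u t) r z‖ₑ ^ 3 ≤ 8 * (‖w r z‖ₑ ^ 3 + κ r ^ 3) := by
    have hui : Integrable (u z.1) := (Lp.memLp (u z.1)).integrable one_le_two
    have hφc : Continuous (φ z.1) := by
      have h1 : Continuous fun x => d z.1 x := hdc.comp (Continuous.prodMk_right (z.1 : ℝ))
      exact continuous_const.sub (Real.smoothTransition.continuous.comp
        ((h1.div_const _).sub continuous_const))
    have hi1 : Integrable (fun y => φ z.1 y • u z.1 y) :=
      hui.bdd_smul 1 hφc.aestronglyMeasurable
        (Eventually.of_forall fun y => by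
          rw [Real.norm_of_nonneg (hφ01 _ _).1]; exact (hφ01 _ _).2)
    have hi2 : Integrable (fun y => (1 - φ z.1 y) • u z.1 y) := by
      simp only [sub_smul, one_smul]
      exact hui.sub hi1
    have e : blockST χ (fun t => u t) r z =
        w r z + block χ r (fun y => (1 - φ z.1 y) • u z.1 y) z.2 := by
      rw [hw]
      simp only [blockST]
      rw [← block_add χ r hi1 hi2]
      congr 1
      ext1 y
      rw [← add_smul, add_sub_cancel, one_smul]
    have h2 : ‖block χ r (fun y => (1 - φ z.1 y) • u z.1 y) z.2‖ₑ ≤ κ r := by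
      refine (hC r _ hi2 z.2 (ε / 6) (by positivity) fun y hy => ?_).trans ?_
      · refine exists_separated hz ?_
        by_contra! hle
        apply hy
        simp only [hφ]
        rw [Real.smoothTransition.zero_of_nonpos, sub_zero, sub_self, zero_smul]
        rw [sub_nonpos, div_le_one hε0]
        exact hle
      · refine mul_le_mul' le_rfl ((lintegral_mono fun y => ?_).trans (hBu z.1))
        rw [← ofReal_norm, ← ofReal_norm]
        refine ENNReal.ofReal_le_ofReal ?_
        rw [norm_smul, Real.norm_of_nonneg (by linarith [(hφ01 z.1 y).2])]
        exact mul_le_of_le_one_left (norm_nonneg _) (by linarith [(hφ01 z.1 y).1])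
    rw [e]
    refine (pow_le_pow_left' ((enorm_add_le _ _).trans (add_le_add le_rfl h2)) 3).trans ?_
    set p := ‖w r z‖ₑ
    set k := κ r
    calc (p + k) ^ 3 ≤ (2 * max p k) ^ 3 := by
          refine pow_le_pow_left' ?_ 3
          rw [two_mul]
          exact add_le_add (le_max_left _ _) (le_max_right _ _)
      _ = 8 * (max p k) ^ 3 := by rw [mul_pow]; norm_num
      _ ≤ 8 * (p ^ 3 + k ^ 3) := by
          refine mul_le_mul' le_rfl ?_
          rcases le_total p k with h | h
          · rw [max_eq_right h]; exact le_add_self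
          · rw [max_eq_left h]; exact le_self_add
  have hbound (r : ℕ) : ENNReal.ofReal (lam L r) * ∫⁻ z in {z : SpaceTime L T | d z.1 z.2 < ε / 2},
      ‖blockST χ (fun t => u t) r z‖ₑ ^ 3 ∂avgMeasure L T ≤
        8 * (ENNReal.ofReal (lam L r) * avgPow 3 (w r) +
          ENNReal.ofReal (lam L r) * κ r ^ 3) := by
    rw [← mul_add, mul_left_comm]
    refine mul_le_mul' le_rfl ?_
    refine (setLIntegral_mono' (isOpen_lt hdST continuous_const).measurableSet
      fun z hz => hpt r z hz).trans ((setLIntegral_le_lintegral _ _).trans ?_)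
    rw [lintegral_const_mul' _ _ (by norm_num), lintegral_add_right _ measurable_const, avgPow_eq]
    simp
  -- κ_r³ is of order 8^(-r) and λ_r of order 2^r, which leaves 4^(-r).
  have hκ0 : Tendsto (fun r : ℕ => ENNReal.ofReal (lam L r) * κ r ^ 3) atTop (𝓝 0) := by
    set c := C / (ε / 6) ^ 4 with hc
    have hc0 : 0 ≤ c := by positivity
    have e (r : ℕ) : ENNReal.ofReal (lam L r) * κ r ^ 3 =
        ENNReal.ofReal (c ^ 3 / L * (1 / 4) ^ r) * B ^ 3 := by
      simp only [hκ]
      rw [mul_pow, ← mul_assoc, ← ENNReal.ofReal_pow (by positivity),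
        ← ENNReal.ofReal_mul (lam_pos hL' _).le]
      congr 2
      rw [lam, zpow_natCast, one_div, inv_pow, show (4 : ℝ) = 2 ^ 2 by norm_num, ← pow_mul,
        mul_comm 2 r, pow_mul]
      field_simp
    simp only [e]
    have h1 : Tendsto (fun r : ℕ => c ^ 3 / L * (1 / 4 : ℝ) ^ r) atTop (𝓝 (c ^ 3 / L * 0)) :=
      (tendsto_pow_atTop_nhds_zero_of_lt_one (by norm_num) (by norm_num)).const_mul _
    have h2 := ENNReal.Tendsto.mul_const (ENNReal.tendsto_ofReal h1)
      (Or.inr (ENNReal.pow_ne_top hB (n := 3)))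
    simpa using h2
  have hsum := ENNReal.Tendsto.const_mul (a := 8) (htend.add hκ0) (Or.inr (by norm_num))
  rw [add_zero, mul_zero] at hsum
  exact tendsto_of_tendsto_of_tendsto_of_le_of_le tendsto_const_nhds hsum (fun _ => zero_le)
    hbound

/-- The blocks decay on compact sets that do not meet the singular set. -/
lemma tendsto_blocks_of_compact (χ : Cutoff) {L T : ℝ} [hL : Fact (0 < L)] (hT : 0 < T)
    {u : Icc (0 : ℝ) T → L2Field L} (hu : WeaklyContinuous u) {K : Set (SpaceTime L T)}
    (hK : IsCompact K) (hKS : Disjoint K (singularSet χ (fun t => u t))) :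
    Tendsto (fun r : ℕ => ENNReal.ofReal (lam L r) *
      ∫⁻ z in K, ‖blockST χ (fun t => u t) r z‖ₑ ^ 3 ∂avgMeasure L T) atTop (𝓝 0) := by
  refine hK.induction_on (p := fun K => Tendsto (fun r : ℕ => ENNReal.ofReal (lam L r) *
      ∫⁻ z in K, ‖blockST χ (fun t => u t) r z‖ₑ ^ 3 ∂avgMeasure L T) atTop (𝓝 0))
    (by simp) (fun s t hst ht => ?_) (fun s t hs ht => ?_) (fun z hz => ?_)
  · exact tendsto_of_tendsto_of_tendsto_of_le_of_le tendsto_const_nhds ht (fun _ => zero_le)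
      fun r => mul_le_mul' le_rfl (lintegral_mono_set hst)
  · have := hs.add ht
    rw [add_zero] at this
    refine tendsto_of_tendsto_of_tendsto_of_le_of_le tendsto_const_nhds this (fun _ => zero_le)
      fun r => ?_
    simp only
    rw [← mul_add]
    exact mul_le_mul' le_rfl (lintegral_union_le _ _ _)
  · have h1 := hKS.notMem_of_mem_left hz
    rw [singularSet, notMem_compl_iff] at h1
    obtain ⟨U, ⟨hUo, hUr⟩, hzU⟩ := h1
    obtain ⟨V, hV, hzV, hVt⟩ := exists_nhds_tendsto_blocks χ hT hu hUo hUr hzU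
    exact ⟨V, mem_nhdsWithin_of_mem_nhds (hV.mem_nhds hzV), hVt⟩

/-! ### Smooth functions on the torus -/

section Smooth

variable {L : ℝ} {F : Type*} [NormedAddCommGroup F] [NormedSpace ℝ F]

lemma toTorus_add_smul_single (y : E3) (i : Fin 3) (s : ℝ) :
    toTorus L (y + s • EuclideanSpace.single i 1) =
      toTorus L y + Pi.single i (s : AddCircle L) := by
  rw [toTorus_add]
  congr 1
  ext j
  by_cases h : j = i
  · subst h; simp [toTorus]
  · simp [toTorus, h]

lemma SmoothOnTorus.hasDerivAt {g : Torus L → F} (hg : SmoothOnTorus g) (i : Fin 3) (y : E3) :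
    HasDerivAt (fun s : ℝ => g (toTorus L y + Pi.single i (s : AddCircle L)))
      (fderiv ℝ (fun y => g (toTorus L y)) y (EuclideanSpace.single i 1)) 0 := by
  have h1 := (ContDiff.differentiable hg (by simp) (y + (0 : ℝ) • EuclideanSpace.single i 1)).hasFDerivAt
  have h2 := h1.comp_hasDerivAt (0 : ℝ)
    (((hasDerivAt_id (0 : ℝ)).smul_const (EuclideanSpace.single i (1 : ℝ))).const_add y)
  have h3 : (fun s : ℝ => g (toTorus L y + Pi.single i (s : AddCircle L))) =
      (fun y => g (toTorus L y)) ∘ fun s : ℝ => y + id s • EuclideanSpace.single i 1 := by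
    ext s
    simp only [Function.comp, id, toTorus_add_smul_single]
  rw [h3]
  simpa using h2

lemma SmoothOnTorus.pderiv {g : Torus L → F} (hg : SmoothOnTorus g) (i : Fin 3) :
    SmoothOnTorus (pderiv i g) := by
  have h : (fun y : E3 => Intermittency.pderiv i g (toTorus L y)) =
      fun y => fderiv ℝ (fun y => g (toTorus L y)) y (EuclideanSpace.single i 1) :=
    funext fun y => (hg.hasDerivAt i y).deriv
  unfold SmoothOnTorus
  rw [h]
  exact (ContDiff.fderiv_right (m := ∞) hg (by simp)).clm_apply contDiff_const

lemma SmoothOnTorus.pderiv_iterate {g : Torus L → F} (hg : SmoothOnTorus g) (i : Fin 3) (n : ℕ) :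
    SmoothOnTorus ((Intermittency.pderiv i)^[n] g) := by
  induction n with
  | zero => exact hg
  | succ n ih => rw [Function.iterate_succ_apply']; exact ih.pderiv i

lemma pderiv_iterate_sum {ι : Type*} (s : Finset ι) (a : ι → ℝ) {B : ι → Torus L → F}
    (hB : ∀ α, SmoothOnTorus (B α)) (i : Fin 3) (n : ℕ) :
    (pderiv i)^[n] (fun x => ∑ α ∈ s, a α • B α x) =
      fun x => ∑ α ∈ s, a α • (pderiv i)^[n] (B α) x := by
  induction n with
  | zero => rfl
  | succ n ih =>
    rw [Function.iterate_succ_apply', ih]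
    ext x
    obtain ⟨y, rfl⟩ := toTorus_surjective L x
    have h1 (α : ι) := ((hB α).pderiv_iterate i n).hasDerivAt i y
    have h2 := HasDerivAt.fun_sum fun α (_ : α ∈ s) => (h1 α).const_smul (a α)
    rw [pderiv]
    refine h2.deriv.trans (Finset.sum_congr rfl fun α _ => ?_)
    rw [Function.iterate_succ_apply', pderiv, (h1 α).deriv]

lemma mderiv_sum {ι : Type*} (s : Finset ι) (a : ι → ℝ) {B : ι → Torus L → F}
    (hB : ∀ α, SmoothOnTorus (B α)) (β : Fin 3 → ℕ) :
    mderiv β (fun x => ∑ α ∈ s, a α • B α x) = fun x => ∑ α ∈ s, a α • mderiv β (B α) x := by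
  unfold mderiv
  rw [pderiv_iterate_sum s a hB, pderiv_iterate_sum s a fun α => (hB α).pderiv_iterate 2 _,
    pderiv_iterate_sum s a fun α => ((hB α).pderiv_iterate 2 _).pderiv_iterate 1 _]

end Smooth

lemma contDiff_character_toTorus (L : ℝ) (k : Fin 3 → ℤ) :
    ContDiff ℝ ∞ (fun y : E3 => character k (toTorus L y)) := by
  simp only [character_toTorus]
  have (i : Fin 3) : ContDiff ℝ ∞ (fun y : E3 => ((y i : ℝ) : ℂ)) :=
    Complex.ofRealCLM.contDiff.comp (EuclideanSpace.proj (𝕜 := ℝ) i).contDiff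
  exact ((contDiff_const.mul (ContDiff.sum fun i _ => contDiff_const.mul (this i))).div_const _).cexp

/-! ### The dyadic cubes -/

lemma lam_natCast (L : ℝ) (q : ℕ) : lam L q = 2 ^ q / L := by rw [lam, zpow_natCast]

/-- Since λ_q L = 2^q, a period in y moves the floor of λ_q y by a multiple of 2^q. Cubes thereby
become residue classes of integer vectors, and the later geometry is integer arithmetic. -/
lemma mem_dyadicCube {L : ℝ} (hL : 0 < L) (q : ℕ) (k : Fin 3 → ℤ) (y : E3) :
    toTorus L y ∈ dyadicCube L q k ↔ ∀ i, (2 ^ q : ℤ) ∣ ⌊lam L q * y i⌋ - k i := by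
  have hl := lam_pos hL q
  have key (w : ℝ) (n : ℤ) : w - ell L q * n ∈ Ico 0 (ell L q) ↔ ⌊lam L q * w⌋ = n := by
    rw [Int.floor_eq_iff, ell, mem_Ico, sub_nonneg, inv_mul_le_iff₀ hl, sub_lt_iff_lt_add,
      ← mul_one_add, lt_inv_mul_iff₀ hl, add_comm]
  have hlL (w : ℝ) (m : ℤ) : ⌊lam L q * (w + m * L)⌋ = ⌊lam L q * w⌋ + 2 ^ q * m := by
    have : lam L q * (w + m * L) = lam L q * w + ((2 ^ q * m : ℤ) : ℝ) := by
      rw [lam_natCast]; push_cast; field_simp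
    rw [this, Int.floor_add_intCast]
  constructor
  · rintro ⟨w, hw, hwy⟩ i
    have h1 : ((w i : ℝ) : AddCircle L) = (y i : ℝ) := congrFun hwy i
    rw [eq_comm, ← sub_eq_zero, ← AddCircle.coe_sub, AddCircle.coe_eq_zero_iff] at h1
    obtain ⟨m, hm⟩ := h1
    have h2 : y i = w i + m * L := by rw [zsmul_eq_mul] at hm; linarith
    rw [h2, hlL, (key _ _).1 (hw i)]
    exact ⟨m, by ring⟩
  · intro h
    choose m hm using h
    refine ⟨WithLp.toLp 2 fun i => y i + ((-m i : ℤ) : ℝ) * L, fun i => ?_, ?_⟩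
    · simp only [key, hlL]
      linarith [hm i]
    · ext i
      simp only [toTorus]
      rw [← sub_eq_zero, ← AddCircle.coe_sub, AddCircle.coe_eq_zero_iff]
      exact ⟨-m i, by rw [zsmul_eq_mul]; ring⟩

lemma measurableSet_preimage_dyadicCube {L : ℝ} (hL : 0 < L) (q : ℕ) (k : Fin 3 → ℤ) :
    MeasurableSet (toTorus L ⁻¹' dyadicCube L q k) := by
  have : toTorus L ⁻¹' dyadicCube L q k =
      ⋂ i, (fun y : E3 => ⌊lam L q * y i⌋) ⁻¹' {n | (2 ^ q : ℤ) ∣ n - k i} := by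
    ext y; simp [mem_dyadicCube hL]
  rw [this]
  refine MeasurableSet.iInter fun i => ?_
  have : Measurable fun y : E3 => ⌊lam L q * y i⌋ :=
    Int.measurable_floor.comp (by fun_prop)
  exact this (MeasurableSet.of_discrete)

/-! ### The mollified cubes as a partition of unity -/

/-- The rescaled approximation kernel. -/
def ApproxKernel.scaled (η : ApproxKernel) (L : ℝ) (q : ℕ) (y : E3) : ℝ :=
  2 ^ (3 * q) * η.toFun (lam L q • y)

lemma ApproxKernel.hasCompactSupport (η : ApproxKernel) : HasCompactSupport η.toFun :=
  (isCompact_closedBall (0 : E3) 1).of_isClosed_subset (isClosed_tsupport _) η.support_subset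

lemma ApproxKernel.scaled_hasCompactSupport (η : ApproxKernel) {L : ℝ} (hL : 0 < L) (q : ℕ) :
    HasCompactSupport (η.scaled L q) :=
  (η.hasCompactSupport.comp_smul (lam_pos hL q).ne').mul_left

lemma ApproxKernel.scaled_contDiff (η : ApproxKernel) (L : ℝ) (q : ℕ) :
    ContDiff ℝ ∞ (η.scaled L q) :=
  contDiff_const.mul (η.smooth.comp (contDiff_const_smul _))

lemma ApproxKernel.integral_scaled (η : ApproxKernel) {L : ℝ} (hL : 0 < L) (q : ℕ) :
    ∫ y, η.scaled L q y = L ^ 3 := by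
  unfold ApproxKernel.scaled
  rw [integral_const_mul, Measure.integral_comp_smul, η.integral_eq_one, finrank_euclideanSpace,
    Fintype.card_fin, lam_natCast, abs_of_pos (by positivity)]
  rw [smul_eq_mul, div_pow, ← pow_mul, mul_comm q 3]
  field_simp

/-- Lifted to the covering space, the bump is a smooth compactly supported kernel convolved with a
locally integrable periodic indicator. -/
lemma smoothOnTorus_cubeBump (η : ApproxKernel) {L : ℝ} (hL : 0 < L) (q : ℕ) (k : Fin 3 → ℤ) :
    SmoothOnTorus (cubeBump η L q k) := by
  set I : E3 → ℝ := (toTorus L ⁻¹' dyadicCube L q k).indicator fun _ => 1 with hI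
  have hloc : LocallyIntegrable I :=
    (locallyIntegrable_const (1 : ℝ)).indicator (measurableSet_preimage_dyadicCube hL q k)
  have h1 := (η.scaled_hasCompactSupport hL q).contDiff_convolution_left
    (ContinuousLinearMap.mul ℝ ℝ) (η.scaled_contDiff L q) hloc (μ := volume)
  have h2 : (fun y : E3 => cubeBump η L q k (toTorus L y)) =
      fun y => 1 / L ^ 3 * MeasureTheory.convolution (η.scaled L q) I
        (ContinuousLinearMap.mul ℝ ℝ) volume y := by
    ext x
    rw [cubeBump, MeasureTheory.convolution]
    congr 2
    ext y
    rw [← toTorus_sub, ContinuousLinearMap.mul_apply', mul_comm]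
    rfl
  unfold SmoothOnTorus
  rw [h2]
  exact contDiff_const.mul h1

/-- The indices of the cubes of generation `q`. -/
def cubeIndices (q : ℕ) : Finset (Fin 3 → ℤ) := Fintype.piFinset fun _ => Finset.Ico 0 (2 ^ q)

lemma mem_cubeIndices {q : ℕ} {k : Fin 3 → ℤ} : k ∈ cubeIndices q ↔ ∀ i, 0 ≤ k i ∧ k i < 2 ^ q := by
  simp [cubeIndices]

lemma sum_indicator_dyadicCube {L : ℝ} (hL : 0 < L) (q : ℕ) (x : Torus L) :
    ∑ k ∈ cubeIndices q, (dyadicCube L q k).indicator (fun _ => (1 : ℝ)) x = 1 := by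
  obtain ⟨y, rfl⟩ := toTorus_surjective L x
  have h2 : (0 : ℤ) < 2 ^ q := by positivity
  rw [Finset.sum_eq_single fun i => ⌊lam L q * y i⌋ % 2 ^ q]
  · rw [indicator_of_mem]
    rw [mem_dyadicCube hL]
    exact fun i => Int.dvd_self_sub_emod
  · intro k hk hne
    rw [indicator_of_notMem]
    contrapose! hne
    rw [mem_dyadicCube hL] at hne
    rw [mem_cubeIndices] at hk
    ext i
    rw [Int.emod_eq_emod_iff_emod_sub_eq_zero.2 (Int.emod_eq_zero_of_dvd (hne i)), Int.emod_eq_of_lt (hk i).1 (hk i).2]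
  · intro h
    exact absurd (mem_cubeIndices.2 fun i => ⟨Int.emod_nonneg _ h2.ne', Int.emod_lt_of_pos _ h2⟩) h

lemma sum_cubeBump (η : ApproxKernel) {L : ℝ} (hL : 0 < L) (q : ℕ) (x : Torus L) :
    ∑ k ∈ cubeIndices q, cubeBump η L q k x = 1 := by
  obtain ⟨x₀, rfl⟩ := toTorus_surjective L x
  have hint : Integrable (η.scaled L q) :=
    (η.scaled_contDiff L q).continuous.integrable_of_hasCompactSupport
      (η.scaled_hasCompactSupport hL q)
  have hi (k : Fin 3 → ℤ) : Integrable fun y : E3 =>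
      (dyadicCube L q k).indicator (fun _ => (1 : ℝ)) (toTorus L x₀ - toTorus L y) *
        (2 ^ (3 * q) * η.toFun (lam L q • y)) := by
    refine Integrable.bdd_mul (c := 1) hint ?_ (Eventually.of_forall fun y => ?_)
    · have h1 : Measurable ((toTorus L ⁻¹' dyadicCube L q k).indicator fun _ => (1 : ℝ)) :=
        measurable_const.indicator (measurableSet_preimage_dyadicCube hL q k)
      have h2 : Measurable fun y : E3 => x₀ - y := by fun_prop
      refine (h1.comp h2).aestronglyMeasurable.congr (Eventually.of_forall fun y => ?_)
      simp only [← toTorus_sub]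
      rfl
    · simp only [indicator]; split_ifs <;> simp
  unfold cubeBump
  rw [← Finset.mul_sum, ← integral_finsetSum _ fun k _ => hi k]
  simp only [← Finset.sum_mul, sum_indicator_dyadicCube hL, one_mul]
  have := η.integral_scaled hL q
  unfold ApproxKernel.scaled at this
  rw [this]
  field_simp

/-- η lives in the unit ball, so mollification moves each coordinate of λ_q x by at most 1 and its
floor by at most 1. -/
lemma exists_of_cubeBump_ne_zero {η : ApproxKernel} {L : ℝ} (hL : 0 < L) {q : ℕ}
    {k : Fin 3 → ℤ} {x₀ : E3} (h : cubeBump η L q k (toTorus L x₀) ≠ 0) :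
    ∃ d : Fin 3 → ℤ, (∀ i, |d i| ≤ 1) ∧
      ∀ i, (2 ^ q : ℤ) ∣ ⌊lam L q * x₀ i⌋ + d i - k i := by
  have hl := lam_pos hL q
  obtain ⟨y, hy⟩ : ∃ y : E3, (dyadicCube L q k).indicator (fun _ => (1 : ℝ))
      (toTorus L x₀ - toTorus L y) * (2 ^ (3 * q) * η.toFun (lam L q • y)) ≠ 0 := by
    by_contra! h0
    apply h
    simp only [cubeBump, h0, integral_zero, mul_zero]
  have h1 := mem_of_indicator_ne_zero (left_ne_zero_of_mul hy)
  have h2 : lam L q • y ∈ Metric.closedBall (0 : E3) 1 :=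
    η.support_subset (subset_tsupport _ (right_ne_zero_of_mul (right_ne_zero_of_mul hy)))
  rw [mem_closedBall_zero_iff] at h2
  rw [← toTorus_sub, mem_dyadicCube hL] at h1
  refine ⟨fun i => ⌊lam L q * (x₀ - y) i⌋ - ⌊lam L q * x₀ i⌋, fun i => ?_, fun i => ?_⟩
  · have h3 : |lam L q * y i| ≤ 1 := (PiLp.norm_apply_le (lam L q • y) i).trans h2
    rw [abs_le] at h3
    have h4 : lam L q * (x₀ - y) i = lam L q * x₀ i - lam L q * y i := by
      rw [PiLp.sub_apply]; ring
    beta_reduce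
    rw [h4, abs_le]
    have h5 := Int.floor_le_floor (show lam L q * x₀ i - lam L q * y i ≤
      lam L q * x₀ i + ((1 : ℤ) : ℝ) by push_cast; linarith)
    have h6 := Int.floor_le_floor (show lam L q * x₀ i - ((1 : ℤ) : ℝ) ≤
      lam L q * x₀ i - lam L q * y i by push_cast; linarith)
    rw [Int.floor_add_intCast] at h5
    rw [Int.floor_sub_intCast] at h6
    constructor <;> linarith
  · simpa using h1 i

lemma card_filter_cubeBump_le (η : ApproxKernel) {L : ℝ} (hL : 0 < L) (q : ℕ) (x : Torus L) :
    ((cubeIndices q).filter fun k => cubeBump η L q k x ≠ 0).card ≤ 27 := by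
  obtain ⟨x₀, rfl⟩ := toTorus_surjective L x
  have hsub : ((cubeIndices q).filter fun k => cubeBump η L q k (toTorus L x₀) ≠ 0) ⊆
      (freqBox 1).image fun d i => (⌊lam L q * x₀ i⌋ + d i) % 2 ^ q := by
    intro k hk
    rw [Finset.mem_filter, mem_cubeIndices] at hk
    obtain ⟨d, hd, hdk⟩ := exists_of_cubeBump_ne_zero hL hk.2
    refine Finset.mem_image.2 ⟨d, mem_freqBox.2 (by simpa using hd), funext fun i => ?_⟩
    rw [Int.emod_eq_emod_iff_emod_sub_eq_zero.2 (Int.emod_eq_zero_of_dvd (hdk i)),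
      Int.emod_eq_of_lt (hk.1 i).1 (hk.1 i).2]
  refine (Finset.card_le_card hsub).trans (Finset.card_image_le.trans ?_)
  rw [card_freqBox]; norm_num

lemma isOpenMap_toTorus (L : ℝ) : IsOpenMap (toTorus L) := by
  have h1 : IsOpenMap (fun y : Fin 3 → ℝ => fun i => (y i : AddCircle L)) :=
    IsOpenMap.piMap (fun _ => QuotientAddGroup.isOpenMap_coe)
      (Eventually.of_forall fun _ => QuotientAddGroup.mk_surjective)
  exact h1.comp (EuclideanSpace.equiv (Fin 3) ℝ).toHomeomorph.isOpenMap

/-- Mollification moves the index by at most 1 and passing to a nearby point by at most 1 more; the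
total 2 stays below the dilation 3. Openness of the covering map puts x in the interior. -/
lemma mem_dilatedCube_of_cubeBump_ne_zero {η : ApproxKernel} {L : ℝ} (hL : 0 < L) {q : ℕ}
    {k : Fin 3 → ℤ} {x : Torus L} (h : cubeBump η L q k x ≠ 0) : x ∈ dilatedCube L q k := by
  obtain ⟨x₀, rfl⟩ := toTorus_surjective L x
  obtain ⟨d, hd, hdk⟩ := exists_of_cubeBump_ne_zero hL h
  have hO : IsOpen {y : E3 | ∀ i, |lam L q * y i - lam L q * x₀ i| < 1} := by
    simp only [ofPred_forall]
    exact isOpen_iInter_of_finite fun i => isOpen_lt (by fun_prop) continuous_const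
  rw [dilatedCube]
  refine interior_maximal ?_ (isOpenMap_toTorus L _ hO) ⟨x₀, by simp, rfl⟩
  rintro _ ⟨y, hy, rfl⟩
  rw [mem_iUnion₂]
  choose m hm using hdk
  refine ⟨fun i => ⌊lam L q * y i⌋ - 2 ^ q * m i, fun i => ?_, ?_⟩
  · have h1 := abs_lt.1 (hy i)
    have h2 := abs_le.1 (hd i)
    have h5 := Int.floor_le_floor (show lam L q * y i ≤ lam L q * x₀ i + ((1 : ℤ) : ℝ) by
      push_cast; linarith)
    have h6 := Int.floor_le_floor (show lam L q * x₀ i - ((1 : ℤ) : ℝ) ≤ lam L q * y i by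
      push_cast; linarith)
    rw [Int.floor_add_intCast] at h5
    rw [Int.floor_sub_intCast] at h6
    have h7 := hm i
    rw [abs_lt]
    constructor <;> linarith
  · rw [mem_dyadicCube hL]
    exact fun i => ⟨m i, by ring⟩

/-! ### The active regions -/

/-- The block of index `q` as a finite combination of fixed smooth fields. -/
lemma block_eq_sum (χ : Cutoff) {L : ℝ} [Fact (0 < L)] (q : ℤ) (v : Torus L → E3) (x : Torus L) :
    block χ q v x = ∑ α ∈ freqBox (freqBound q) ×ˢ (Finset.univ : Finset (Fin 3)) ×ˢ
        (Finset.univ : Finset Bool),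
      (multiplier χ L q (freq L α.1) * cond α.2.2 (fourierCoef v α.1 α.2.1).re
        (-(fourierCoef v α.1 α.2.1).im)) •
        ((cond α.2.2 (character α.1 x).re (character α.1 x).im) •
          (EuclideanSpace.single α.2.1 (1 : ℝ) : E3)) := by
  ext j
  rw [block_apply, Finset.sum_product, Complex.re_sum, WithLp.ofLp_sum, Finset.sum_apply]
  refine Finset.sum_congr rfl fun k _ => ?_
  rw [Finset.sum_product, WithLp.ofLp_sum, Finset.sum_apply, Finset.sum_eq_single j]
  · simp
    ring
  · intro i _ hij
    simp [hij.symm]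
  · simp

/-- Time enters only through finitely many Fourier coefficients, which are continuous; the
derivatives fall on fixed smooth fields. -/
lemma WeaklyContinuous.continuous_mderiv_bump_smul_block {L T : ℝ} [hL : Fact (0 < L)]
    {u : Icc (0 : ℝ) T → L2Field L} (hu : WeaklyContinuous u) (χ : Cutoff) (q : ℤ)
    {b : Torus L → ℝ} (hb : SmoothOnTorus b) (β : Fin 3 → ℕ) (x : Torus L) :
    Continuous fun t => mderiv β (fun y => b y • block χ q (u t) y) x := by
  set B : (Fin 3 → ℤ) × Fin 3 × Bool → Torus L → E3 := fun α y =>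
    b y • ((cond α.2.2 (character α.1 y).re (character α.1 y).im) •
      (EuclideanSpace.single α.2.1 (1 : ℝ) : E3)) with hB
  have hBs (α) : SmoothOnTorus (B α) := by
    have h1 : ContDiff ℝ ∞ fun y : E3 =>
        cond α.2.2 (character α.1 (toTorus L y)).re (character α.1 (toTorus L y)).im := by
      have hc := contDiff_character_toTorus L α.1
      cases α.2.2
      · exact Complex.imCLM.contDiff.comp hc
      · exact Complex.reCLM.contDiff.comp hc
    exact ContDiff.smul hb (h1.smul contDiff_const)
  have e (t : Icc (0 : ℝ) T) : (fun y => b y • block χ q (u t) y) = fun y =>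
      ∑ α ∈ freqBox (freqBound q) ×ˢ (Finset.univ : Finset (Fin 3)) ×ˢ
        (Finset.univ : Finset Bool),
      (multiplier χ L q (freq L α.1) * cond α.2.2 (fourierCoef (u t) α.1 α.2.1).re
        (-(fourierCoef (u t) α.1 α.2.1).im)) • B α y := by
    ext1 y
    rw [block_eq_sum, Finset.smul_sum]
    exact Finset.sum_congr rfl fun α _ => smul_comm _ _ _
  simp only [e, mderiv_sum _ _ hBs]
  refine continuous_finsetSum _ fun α _ => ?_
  have hc := hu.continuous_fourierCoef α.1 α.2.1
  have h1 : Continuous fun t => cond α.2.2 (fourierCoef (u t) α.1 α.2.1).re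
      (-(fourierCoef (u t) α.1 α.2.1).im) := by
    cases α.2.2
    · exact (Complex.continuous_im.comp hc).neg
    · exact Complex.continuous_re.comp hc
  fun_prop

/-- A supremum of continuous functions of time is lower semicontinuous, just enough for the strict
superlevel sets defining the active regions to be open. -/
lemma WeaklyContinuous.lowerSemicontinuous_atomCoef {L T : ℝ} [hL : Fact (0 < L)]
    {u : Icc (0 : ℝ) T → L2Field L} (hu : WeaklyContinuous u) (χ : Cutoff) (η : ApproxKernel)
    (M q : ℕ) (k : Fin 3 → ℤ) : LowerSemicontinuous fun t => atomCoef χ η M (u t) q k := by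
  unfold atomCoef
  refine lowerSemicontinuous_biSup fun β _ => ?_
  simp only [ENNReal.mul_iSup]
  refine lowerSemicontinuous_iSup fun x => Continuous.lowerSemicontinuous ?_
  exact (ENNReal.continuous_const_mul ENNReal.ofReal_ne_top).comp
    (hu.continuous_mderiv_bump_smul_block χ q (smoothOnTorus_cubeBump η hL.out q k) β x).enorm

lemma WeaklyContinuous.isOpen_activeRegion {L T : ℝ} [hL : Fact (0 < L)]
    {u : Icc (0 : ℝ) T → L2Field L} (hu : WeaklyContinuous u) (χ : Cutoff) (η : ApproxKernel)
    (M : ℕ) (σ : ℕ → ℝ) (q : ℕ) : IsOpen (activeRegion χ η M σ (fun t => u t) q) := by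
  have : activeRegion χ η M σ (fun t => u t) q =
      ⋃ k ∈ {k : Fin 3 → ℤ | ∀ i, 0 ≤ k i ∧ k i < 2 ^ q},
        (Prod.fst ⁻¹' {t | ENNReal.ofReal (σ q) *
          (avgPow 3 (blockST χ (fun t => u t) q : SpaceTime L T → E3) /
            avgPow 2 (blockST χ (fun t => u t) q : SpaceTime L T → E3)) <
              atomCoef χ η M (u t) q k}) ∩ Prod.snd ⁻¹' dilatedCube L q k := by
    ext z
    simp only [activeRegion, mem_iUnion, exists_prop]
    rfl
  rw [this]
  refine isOpen_biUnion fun k _ => IsOpen.inter ?_ (isOpen_interior.preimage continuous_snd)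
  exact ((hu.lowerSemicontinuous_atomCoef χ η M q k).isOpen_preimage _).preimage continuous_fst

lemma enorm_bump_smul_block_le_atomCoef (χ : Cutoff) (η : ApproxKernel) (M : ℕ) {L : ℝ}
    [Fact (0 < L)] (v : Torus L → E3) (q : ℕ) (k : Fin 3 → ℤ) (x : Torus L) :
    ‖cubeBump η L q k x • block χ q v x‖ₑ ≤ atomCoef χ η M v q k := by
  unfold atomCoef
  refine le_iSup₂_of_le (0 : Fin 3 → ℕ) (by simp) ?_
  have h := le_iSup (fun x : Torus L => ‖mderiv 0 (fun y => cubeBump η L q k y • block χ q v y) x‖ₑ) x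
  simpa [mderiv] using h

/-- Outside the active region the block is controlled by the threshold. -/
lemma enorm_block_le_of_notMem_activeRegion (χ : Cutoff) (η : ApproxKernel) (M : ℕ) (σ : ℕ → ℝ)
    {L T : ℝ} [hL : Fact (0 < L)] {v : Icc (0 : ℝ) T → Torus L → E3} {q : ℕ} {z : SpaceTime L T}
    (hz : z ∉ activeRegion χ η M σ v q) :
    ‖blockST χ v q z‖ₑ ≤ 27 * (ENNReal.ofReal (σ q) *
      (avgPow 3 (blockST χ v q) / avgPow 2 (blockST χ v q))) := by
  set θ := ENNReal.ofReal (σ q) * (avgPow 3 (blockST χ v q) / avgPow 2 (blockST χ v q)) with hθ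
  set S := (cubeIndices q).filter fun k => cubeBump η L q k z.2 ≠ 0 with hS
  have h1 : blockST χ v q z = ∑ k ∈ S, cubeBump η L q k z.2 • block χ q (v z.1) z.2 := by
    rw [← Finset.sum_smul, hS, Finset.sum_filter_ne_zero, sum_cubeBump η hL.out, one_smul]
    rfl
  calc ‖blockST χ v q z‖ₑ ≤ ∑ k ∈ S, ‖cubeBump η L q k z.2 • block χ q (v z.1) z.2‖ₑ := by
        rw [h1]; exact enorm_sum_le _ _
    _ ≤ ∑ k ∈ S, θ := by
        refine Finset.sum_le_sum fun k hk => ?_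
        rw [hS, Finset.mem_filter, mem_cubeIndices] at hk
        refine (enorm_bump_smul_block_le_atomCoef χ η M (v z.1) q k z.2).trans ?_
        by_contra! hlt
        exact hz ⟨k, hk.1, hlt, mem_dilatedCube_of_cubeBump_ne_zero hL.out hk.2⟩
    _ = S.card * θ := by rw [Finset.sum_const, nsmul_eq_mul]
    _ ≤ 27 * θ := by
        refine mul_le_mul' ?_ le_rfl
        exact_mod_cast card_filter_cubeBump_le η hL.out q z.2

/-- The blocks decay on sets that avoid all active regions of large index. -/
lemma tendsto_blocks_of_inactive (χ : Cutoff) (η : ApproxKernel) (M : ℕ) {σ : ℕ → ℝ}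
    (hσ : Tendsto σ atTop (𝓝 0)) {L T : ℝ} [hL : Fact (0 < L)]
    {u : Icc (0 : ℝ) T → L2Field L} (hu : WeaklyContinuous u)
    (hε : onsager χ (fun t => u t) < ⊤) {E : Set (SpaceTime L T)}
    (hEm : MeasurableSet E) {q₀ : ℕ}
    (hE : ∀ q > q₀, Disjoint E (activeRegion χ η M σ (fun t => u t) q)) :
    Tendsto (fun r : ℕ => ENNReal.ofReal (lam L r) *
      ∫⁻ z in E, ‖blockST χ (fun t => u t) r z‖ₑ ^ 3 ∂avgMeasure L T) atTop (𝓝 0) := by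
  obtain ⟨B, hB, -⟩ := ENNReal.lt_iff_exists_nnreal_btwn.1 hε
  have hlim : Tendsto (fun r : ℕ => 27 * ENNReal.ofReal (σ r) * (B : ℝ≥0∞)) atTop (𝓝 0) := by
    have h1 := ENNReal.tendsto_ofReal hσ
    rw [ENNReal.ofReal_zero] at h1
    have h2 := ENNReal.Tendsto.mul_const (b := (B : ℝ≥0∞))
      (ENNReal.Tendsto.const_mul (a := 27) h1 (Or.inr (by norm_num)))
      (Or.inr ENNReal.coe_ne_top)
    simpa using h2
  refine tendsto_of_tendsto_of_tendsto_of_le_of_le' tendsto_const_nhds hlim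
    (Eventually.of_forall fun _ => zero_le) ?_
  filter_upwards [eventually_lt_of_limsup_lt hB, eventually_gt_atTop q₀] with r hr hrq
  set a3 := avgPow 3 (blockST χ (fun t => u t) r : SpaceTime L T → E3) with ha3
  set a2 := avgPow 2 (blockST χ (fun t => u t) r : SpaceTime L T → E3) with ha2
  have h1 : ∫⁻ z in E, ‖blockST χ (fun t => u t) r z‖ₑ ^ 3 ∂avgMeasure L T ≤
      27 * ENNReal.ofReal (σ r) * a3 := by
    calc ∫⁻ z in E, ‖blockST χ (fun t => u t) r z‖ₑ ^ 3 ∂avgMeasure L T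
        ≤ ∫⁻ z in E, 27 * (ENNReal.ofReal (σ r) * (a3 / a2)) *
            ‖blockST χ (fun t => u t) r z‖ₑ ^ 2 ∂avgMeasure L T := by
          -- Only one of the three factors |u_r| is replaced by the threshold; the other two rebuild
          -- ⟨|u_r|²⟩, which cancels its denominator.
          refine setLIntegral_mono' hEm fun z hz => ?_
          rw [pow_succ, mul_comm]
          exact mul_le_mul' (enorm_block_le_of_notMem_activeRegion χ η M σ
            ((hE r hrq).notMem_of_mem_left hz)) le_rfl
      _ ≤ 27 * (ENNReal.ofReal (σ r) * (a3 / a2)) * a2 := by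
          rw [lintegral_const_mul _ ((hu.continuous_blockST χ r).measurable.enorm.pow_const 2)]
          exact mul_le_mul' le_rfl (setLIntegral_le_lintegral _ _)
      _ = 27 * ENNReal.ofReal (σ r) * (a2 * (a3 / a2)) := by ring
      _ ≤ 27 * ENNReal.ofReal (σ r) * a3 := mul_le_mul' le_rfl ENNReal.mul_div_le
  calc _ ≤ ENNReal.ofReal (lam L r) * (27 * ENNReal.ofReal (σ r) * a3) := mul_le_mul' le_rfl h1
    _ = 27 * ENNReal.ofReal (σ r) * (ENNReal.ofReal (lam L r) * a3) := by ring
    _ ≤ _ := mul_le_mul' le_rfl hr.le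

/-! ### Concentration of the flux -/

lemma isClosed_singularSet (χ : Cutoff) {L T : ℝ} [Fact (0 < L)]
    (v : Icc (0 : ℝ) T → Torus L → E3) : IsClosed (singularSet χ v) :=
  (isOpen_sUnion fun _ h => h.1).isClosed_compl

lemma avgPow_one_indicator {L T : ℝ} [Fact (0 < L)] {E : Set (SpaceTime L T)}
    (hE : MeasurableSet E) (g : SpaceTime L T → ℝ) :
    avgPow 1 (E.indicator g) = ∫⁻ z in E, ‖g z‖ₑ ∂avgMeasure L T := by
  rw [avgPow_eq, ← lintegral_indicator hE]
  simp only [pow_one, enorm_indicator_eq_indicator_enorm]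

theorem fluxConcentratesOn (χ : Cutoff) (η : ApproxKernel) (M : ℕ) {σ : ℕ → ℝ}
    (hσ : Tendsto σ atTop (𝓝 0)) {L T : ℝ} [hL : Fact (0 < L)] (hT : 0 < T)
    {u : Icc (0 : ℝ) T → L2Field L} (hu : WeaklyContinuous u)
    (hε : onsager χ (fun t => u t) < ⊤) :
    FluxConcentratesOn (fun q : ℕ => fluxDensity χ (fun t => u t) q)
      (activeLimsup χ η M σ (fun t => u t) ∩ singularSet χ (fun t => u t)) := by
  set S := singularSet χ (fun t => u t) with hS
  have hSc : IsClosed S := isClosed_singularSet χ _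
  set P : ℕ → Set (SpaceTime L T) :=
    fun p => ⋃ q > p, activeRegion χ η M σ (fun t => u t) q with hP
  have hPo (p : ℕ) : IsOpen (P p) :=
    isOpen_biUnion fun q _ => hu.isOpen_activeRegion χ η M σ q
  have hPa : Antitone P := fun p p' h =>
    biUnion_subset_biUnion_left fun q (hq : p' < q) => h.trans_lt hq
  set W : ℕ → Set (SpaceTime L T) := fun p => Metric.thickening (1 / ((p : ℝ) + 1)) S with hW
  have hWo (p : ℕ) : IsOpen (W p) := Metric.isOpen_thickening
  have hWa : Antitone W := fun p p' h => Metric.thickening_mono (by gcongr) S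
  have hWS : S = ⋂ p, W p := by
    refine subset_antisymm (subset_iInter fun p => Metric.self_subset_thickening (by positivity) S)
      ?_
    conv_rhs => rw [← hSc.closure_eq, Metric.closure_eq_iInter_thickening]
    refine subset_iInter₂ fun δ hδ => ?_
    obtain ⟨n, hn⟩ := exists_nat_one_div_lt hδ
    exact (iInter_subset _ n).trans (Metric.thickening_mono hn.le S)
  have hG : activeLimsup χ η M σ (fun t => u t) ∩ S = ⋂ q, P q ∩ W q := by
    rw [iInter_inter_distrib, ← hWS]
    rfl
  refine ⟨?_, fun q => P q ∩ W q, hPa.inter hWa, fun q => (hPo q).inter (hWo q), hG,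
    fun q => ?_⟩
  · rw [hG]
    exact MeasurableSet.iInter fun q => ((hPo q).inter (hWo q)).measurableSet
  · have h1 : Tendsto (fun r : ℕ => ENNReal.ofReal (lam L r) *
        ∫⁻ z in (P q)ᶜ, ‖blockST χ (fun t => u t) r z‖ₑ ^ 3 ∂avgMeasure L T) atTop (𝓝 0) :=
      tendsto_blocks_of_inactive χ η M hσ hu hε (hPo q).measurableSet.compl (q₀ := q)
        fun r hr => disjoint_compl_left.mono_right
          (subset_biUnion_of_mem (u := fun r => activeRegion χ η M σ (fun t => u t) r) hr)
    -- Space-time is compact, so the complement of the open neighbourhood of S is compact.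
    have h2 := tendsto_blocks_of_compact χ hT hu (hWo q).isClosed_compl.isCompact
      (disjoint_compl_left.mono_right (Metric.self_subset_thickening (by positivity) S))
    have h3 := (tendsto_flux_of_tendsto_blocks χ hT hu hε h1).add
      (tendsto_flux_of_tendsto_blocks χ hT hu hε h2)
    rw [add_zero] at h3
    refine tendsto_of_tendsto_of_tendsto_of_le_of_le tendsto_const_nhds h3 (fun _ => zero_le)
      fun p => ?_
    simp only
    rw [avgPow_one_indicator ((hPo q).inter (hWo q)).measurableSet.compl, compl_inter]
    exact lintegral_union_le _ _ _

end Intermittency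

end

theorem theoremt (L T : ℝ) [Fact (0 < L)] (hT : 0 < T)
    (χ : Intermittency.Cutoff) (η : Intermittency.ApproxKernel) (M : ℕ) (hM : 1 < M)
    (σ : ℕ → ℝ) (hσ : Intermittency.IsThreshold σ)
    (f u₀ : Intermittency.L2Field L) (u : Set.Icc (0 : ℝ) T → Intermittency.L2Field L)
    (hu : Intermittency.IsWeakEulerSolution f u₀ u)
    (hε : Intermittency.onsager χ (fun t => u t) < ⊤) :
    Intermittency.FluxConcentratesOn
      (fun q : ℕ => Intermittency.fluxDensity χ (fun t => u t) q)
      (Intermittency.activeLimsup χ η M σ (fun t => u t) ∩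
        Intermittency.singularSet χ (fun t => u t)) := by
  exact Intermittency.fluxConcentratesOn χ η M hσ.tendsto_zero hT hu.weaklyContinuous hε
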